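/- For a finite set $\Sigma$ of real $n\times n$ matrices, a vector $a\in\mathbb{R}^n$ and an integer $k\ge 0$, let $P_k(\Sigma,a)$ be the convex hull of the set of all points $T_{k-1}\cdots T_1T_0\,a$ with $T_0,\dots,T_{k-1}\in\Sigma$, let $N_k(\Sigma,a)$ be the number of extreme points of $P_k(\Sigma,a)$, and let $N_k(\Sigma)=\sup_{a\in\mathbb{R}^n}N_k(\Sigma,a)$. For $d>0$, write $N_k(\Sigma)=O(k^d)$ if there are $\alpha>0$ and a positive integer $k_0$ such that $N_k(\Sigma)\le\alpha k^d$ for all integers $k\ge k_0$. The set $\Sigma$ has the oligo-vertex property if $N_k(\Sigma)=O(k^d)$ for some constant $d>0$. **Theorem.** Every pair $\{A,B\}$ of $2\times 2$ matrices with entries in $\{0,1\}$ has the oligo-vertex property. Moreover, with $$A_1=\begin{pmatrix}0&1\\1&0\end{pmatrix},\quad A_2=\begin{pmatrix}1&1\\0&1\end{pmatrix},\quad A_3=\begin{pmatrix}1&0\\1&1\end{pmatrix},\quad A_4=\begin{pmatrix}1&1\\1&0\end{pmatrix},\quad A_5=\begin{pmatrix}0&1\\1&1\end{pmatrix},$$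 one has $N_k(\{A_1,A_2\})=O(k^4)$, $N_k(\{A_1,A_4\})=O(k)$, $N_k(\{A_2,A_3\})=O(k^2)$, $N_k(\{A_4,A_5\})=O(k^2)$ and $N_k(\{A_2,A_4\})=O(k^2)$. -/

import Mathlib

namespace OligoVertex

open Matrix
open scoped ENNReal

/-- A matrix is binary if each of its entries is `0` or `1`. -/
def IsBinary {n : ℕ} (A : Matrix (Fin n) (Fin n) ℝ) : Prop :=
  ∀ i j, A i j = 0 ∨ A i j = 1

/-- The trajectory `x(0) = a`, `x(j + 1) = T_j x(j)` of the switched linear system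
with matrix sequence `T`, so that `x(k) = T_{k-1} ⋯ T_0 a`. -/
def trajectory {n : ℕ} (T : ℕ → Matrix (Fin n) (Fin n) ℝ) (a : Fin n → ℝ) : ℕ → (Fin n → ℝ)
  | 0 => a
  | j + 1 => T j *ᵥ trajectory T a j

/-- The set `X_k(S, a)` of all points `T_{k-1} ⋯ T_0 a` with `T_0, …, T_{k-1} ∈ S`. -/
def endpoints {n : ℕ} (S : Set (Matrix (Fin n) (Fin n) ℝ)) (a : Fin n → ℝ) (k : ℕ) :
    Set (Fin n → ℝ) :=
  {x | ∃ T : ℕ → Matrix (Fin n) (Fin n) ℝ, (∀ j < k, T j ∈ S) ∧ x = trajectory T a k}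

/-- The convex hull `P_k(S, a)` of `X_k(S, a)`. -/
def polytope {n : ℕ} (S : Set (Matrix (Fin n) (Fin n) ℝ)) (a : Fin n → ℝ) (k : ℕ) :
    Set (Fin n → ℝ) :=
  convexHull ℝ (endpoints S a k)

/-- The number `N_k(S, a)` of extreme points of `P_k(S, a)`, possibly infinite a priori. -/
noncomputable def numExtremeFrom {n : ℕ} (S : Set (Matrix (Fin n) (Fin n) ℝ)) (a : Fin n → ℝ)
    (k : ℕ) : ℕ∞ :=
  ((polytope S a k).extremePoints ℝ).encard

/-- The supremum `N_k(S)` of `N_k(S, a)` over all initial vectors `a`. It is taken in `ℕ∞`,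
so no boundedness is presupposed. -/
noncomputable def numExtreme {n : ℕ} (S : Set (Matrix (Fin n) (Fin n) ℝ)) (k : ℕ) : ℕ∞ :=
  ⨆ a : Fin n → ℝ, numExtremeFrom S a k

/-- `N_k(S) = O(k ^ d)` as `k → ∞`: there are `α > 0` and a positive integer `k₀` with
`N_k(S) ≤ α k ^ d` for every `k ≥ k₀`; in particular `N_k(S)` is finite for these `k`. -/
def NumExtremeIsBigOPow {n : ℕ} (S : Set (Matrix (Fin n) (Fin n) ℝ)) (d : ℝ) : Prop :=
  ∃ α : ℝ, 0 < α ∧ ∃ k₀ : ℕ, 0 < k₀ ∧ ∀ k : ℕ, k₀ ≤ k →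
    ((numExtreme S k : ℕ∞) : ℝ≥0∞) ≤ ENNReal.ofReal (α * (k : ℝ) ^ d)

/-- The oligo-vertex property: `N_k(S) = O(k ^ d)` for some constant `d > 0`. -/
def HasOligoVertexProperty {n : ℕ} (S : Set (Matrix (Fin n) (Fin n) ℝ)) : Prop :=
  ∃ d : ℝ, 0 < d ∧ NumExtremeIsBigOPow S d

end OligoVertex

namespace OligoVertex

open Matrix
open scoped ENNReal Pointwise

/-! A vertex of the hull of a finite planar set is the unique maximiser of a linear functional, so
it suffices to count exposed points of the orbit at each level, uniformly in the initial vector.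
Functionals are split into the two closed quadrants of constant sign and the two open mixed
quadrants. If `c` exposes `M w` at level `k + 1`, then the transpose of `M` applied to `c` exposes
`w` at level `k`, so the counts obey recursions.

For the two shears and nonnegative functionals, the transposes send the quadrant into two halves
meeting in one ray. At most one point is exposed from both halves, so the count grows by at most one
per step (`card_exposed_add_le`, `card_exposed_posCone_shears`). A mixed functional prefers one
fixed shear at every nonnegative point and the other at every nonpositive point, so the recursion
branches only at mixed points. Each level has at most one of these, and the increments are linear,
which gives a quadratic bound (`card_exposed_mixCone_shears_succ`).

The swap with a shear follows the same plan, with a recursion over two levels because the swap is an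
involution, and with at most `k + 1` mixed points at level `k`. The bound obtained is again
quadratic, stronger than the quartic one claimed. The swap with `shearU ∘ swap` is simpler: a
coordinatewise greatest point exists and there is no branching.

The other pairs of distinct nonsingular, nonidentity matrices reduce to these by conjugating with
the swap or by rewriting their orbits through orbits of the shears. Commuting pairs and pairs with a
singular matrix are counted directly. -/

/-! ### Exposed points of finite planar sets -/

/-- The value of the linear functional with coefficients `c` at `v`. -/
def pair (c v : Fin 2 → ℝ) : ℝ := c 0 * v 0 + c 1 * v 1

/-- The functional `c` attains its maximum over `X` at the point `v` of `X` only. -/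
def Exposes (c : Fin 2 → ℝ) (X : Finset (Fin 2 → ℝ)) (v : Fin 2 → ℝ) : Prop :=
  v ∈ X ∧ ∀ x ∈ X, x ≠ v → pair c x < pair c v

open Classical in
/-- The points of `X` that are exposed by a functional in `K`. -/
noncomputable def exposed (K : Set (Fin 2 → ℝ)) (X : Finset (Fin 2 → ℝ)) :
    Finset (Fin 2 → ℝ) :=
  X.filter fun v => ∃ c ∈ K, Exposes c X v

variable {c e v w x : Fin 2 → ℝ} {K K₁ K₂ : Set (Fin 2 → ℝ)} {X Y : Finset (Fin 2 → ℝ)}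

lemma mem_exposed : v ∈ exposed K X ↔ ∃ c ∈ K, Exposes c X v := by
  classical
  simp only [exposed, Finset.mem_filter, and_iff_right_iff_imp]
  rintro ⟨c, -, h⟩
  exact h.1

lemma exposed_mono (h : K₁ ⊆ K₂) : exposed K₁ X ⊆ exposed K₂ X := fun v hv => by
  obtain ⟨c, hc, h'⟩ := mem_exposed.1 hv
  exact mem_exposed.2 ⟨c, h hc, h'⟩

lemma exposed_union : exposed (K₁ ∪ K₂) X = exposed K₁ X ∪ exposed K₂ X := by
  classical
  ext v
  simp only [Finset.mem_union, mem_exposed, Set.mem_union]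
  grind

lemma card_exposed_union_le :
    (exposed (K₁ ∪ K₂) X).card ≤ (exposed K₁ X).card + (exposed K₂ X).card := by
  rw [exposed_union]
  exact Finset.card_union_le _ _

lemma Exposes.eq_of_le (h : Exposes c X v) (hx : x ∈ X) (hle : pair c v ≤ pair c x) : x = v := by
  by_contra hne
  exact (h.2 x hx hne).not_ge hle

lemma Exposes.mono (h : Exposes c X v) (hYX : Y ⊆ X) (hv : v ∈ Y) : Exposes c Y v :=
  ⟨hv, fun x hx => h.2 x (hYX hx)⟩

/-- Maximising `c` over images under `T` is maximising the transposed functional `T' c`, and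
injectivity keeps the maximiser unique. Every recursion on levels rests on this. -/
lemma Exposes.of_map {T T' : (Fin 2 → ℝ) → (Fin 2 → ℝ)} (hT : T.Injective)
    (hadj : ∀ c x, pair c (T x) = pair (T' c) x) (hX : ∀ x ∈ X, T x ∈ Y) (hw : w ∈ X)
    (h : Exposes c Y (T w)) : Exposes (T' c) X w :=
  ⟨hw, fun x hx hne => by
    rw [← hadj, ← hadj]
    exact h.2 _ (hX x hx) (hT.ne hne)⟩

/-- If two cones of functionals are separated by the ray of `e`, at most one point is exposed by
both of them. -/
lemma card_exposed_add_le (h₁ : K₁ ⊆ K) (h₂ : K₂ ⊆ K)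
    (he : ∀ c₁ ∈ K₁, ∀ c₂ ∈ K₂, ∃ s t r : ℝ, 0 ≤ s ∧ 0 ≤ t ∧ 0 < s + t ∧ 0 < r ∧
      s • c₁ + t • c₂ = r • e) :
    (exposed K₁ X).card + (exposed K₂ X).card ≤ (exposed K X).card + 1 := by
  classical
  rw [← Finset.card_union_add_card_inter]
  refine add_le_add (Finset.card_le_card
    (Finset.union_subset (exposed_mono h₁) (exposed_mono h₂))) (Finset.card_le_one.2 ?_)
  have key : ∀ v ∈ exposed K₁ X ∩ exposed K₂ X, Exposes e X v := by
    intro v hv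
    obtain ⟨hv₁, hv₂⟩ := Finset.mem_inter.1 hv
    obtain ⟨c₁, hc₁, e₁⟩ := mem_exposed.1 hv₁
    obtain ⟨c₂, hc₂, e₂⟩ := mem_exposed.1 hv₂
    obtain ⟨s, t, r, hs, ht, hst, hr, hsum⟩ := he c₁ hc₁ c₂ hc₂
    refine ⟨e₁.1, fun x hx hne => ?_⟩
    have hval : ∀ y, r * pair e y = s * pair c₁ y + t * pair c₂ y := by
      intro y
      have h0 := congrFun hsum 0
      have h1 := congrFun hsum 1
      simp only [Pi.add_apply, Pi.smul_apply, smul_eq_mul] at h0 h1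
      simp only [pair]
      linear_combination (-y 0) * h0 - y 1 * h1
    have l₁ := e₁.2 x hx hne
    have l₂ := e₂.2 x hx hne
    refine lt_of_mul_lt_mul_left ?_ hr.le
    rw [hval, hval]
    rcases hs.eq_or_lt with rfl | hs
    · have : 0 < t := by linarith
      nlinarith [mul_lt_mul_of_pos_left l₂ this]
    · nlinarith [mul_lt_mul_of_pos_left l₁ hs, mul_le_mul_of_nonneg_left l₂.le ht]
  intro v hv w hw
  by_contra hne
  exact lt_asymm ((key v hv).2 w (key w hw).1 (Ne.symm hne)) ((key w hw).2 v (key v hv).1 hne)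

lemma card_exposed_map_le {T T' : (Fin 2 → ℝ) → (Fin 2 → ℝ)} (hT : T.Injective)
    (hadj : ∀ c x, pair c (T x) = pair (T' c) x) :
    (exposed Set.univ (X.image T)).card ≤ (exposed Set.univ X).card := by
  refine (Finset.card_le_card ?_).trans (Finset.card_image_le (f := T))
  intro v hv
  obtain ⟨c, -, h⟩ := mem_exposed.1 hv
  obtain ⟨w, hw, rfl⟩ := Finset.mem_image.1 h.1
  exact Finset.mem_image_of_mem _ (mem_exposed.2 ⟨T' c, trivial,
    h.of_map hT hadj (fun x hx => Finset.mem_image_of_mem _ hx) hw⟩)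

lemma card_exposed_union_set_le :
    (exposed Set.univ (X ∪ Y)).card ≤ (exposed Set.univ X).card + (exposed Set.univ Y).card := by
  refine (Finset.card_le_card ?_).trans (Finset.card_union_le _ _)
  intro v hv
  obtain ⟨c, -, h⟩ := mem_exposed.1 hv
  rcases Finset.mem_union.1 h.1 with hX | hY
  · exact Finset.mem_union_left _ (mem_exposed.2 ⟨c, trivial, h.mono Finset.subset_union_left hX⟩)
  · exact Finset.mem_union_right _
      (mem_exposed.2 ⟨c, trivial, h.mono Finset.subset_union_right hY⟩)

lemma exposed_subset : exposed K X ⊆ X := fun _ hv => (mem_exposed.1 hv).choose_spec.2.1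

/-- The nonzero functionals with nonnegative coefficients. -/
def posCone : Set (Fin 2 → ℝ) := {c | 0 ≤ c 0 ∧ 0 ≤ c 1 ∧ 0 < c 0 + c 1}

/-- The functionals whose first coefficient is positive and whose second one is negative. -/
def mixCone : Set (Fin 2 → ℝ) := {c | 0 < c 0 ∧ c 1 < 0}

lemma card_exposed_univ_le :
    (exposed Set.univ X).card ≤ (exposed posCone X).card + (exposed (-posCone) X).card +
      ((exposed mixCone X).card + (exposed (-mixCone) X).card) := by
  refine (Finset.card_le_card ?_).trans
    ((card_exposed_union_le (K₁ := posCone ∪ -posCone) (K₂ := mixCone ∪ -mixCone)).trans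
      (add_le_add card_exposed_union_le card_exposed_union_le))
  intro v hv
  obtain ⟨c, -, h⟩ := mem_exposed.1 hv
  by_cases hc : c 0 = 0 ∧ c 1 = 0
  -- The zero functional exposes a point only when it is the whole set, and then any functional
  -- does.
  · refine mem_exposed.2 ⟨![1, 1], Or.inl (Or.inl (by simp [posCone])), h.1, fun x hx hne => ?_⟩
    have := h.2 x hx hne
    simp [pair, hc] at this
  · refine mem_exposed.2 ⟨c, ?_, h⟩
    simp only [posCone, mixCone, Set.mem_union, Set.mem_neg, Set.mem_ofPred_eq, Pi.neg_apply]
    grind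

/-- An extreme point of the convex hull of a finite set is exposed. -/
lemma extremePoints_convexHull_subset_exposed :
    (convexHull ℝ (X : Set (Fin 2 → ℝ))).extremePoints ℝ ⊆ exposed Set.univ X := by
  intro v hv
  have hvX : v ∈ X := by exact_mod_cast extremePoints_convexHull_subset hv
  have hconv := ((convex_convexHull ℝ _).mem_extremePoints_iff_convex_sdiff.1 hv).2
  -- Removing an extreme point leaves the hull convex, so the other points cannot generate `v`; a
  -- functional separating `v` from them exposes it.
  have hnot : v ∉ convexHull ℝ ((X : Set (Fin 2 → ℝ)) \ {v}) := fun h =>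
    (convexHull_min (Set.sdiff_subset_sdiff_left (subset_convexHull ℝ _)) hconv h).2 rfl
  have hclosed : IsClosed (convexHull ℝ ((X : Set (Fin 2 → ℝ)) \ {v})) :=
    ((X.finite_toSet.subset Set.sdiff_subset).isCompact_convexHull (𝕜 := ℝ)).isClosed
  obtain ⟨f, u, hf, hu⟩ := geometric_hahn_banach_closed_point (convex_convexHull ℝ _) hclosed hnot
  have hval : ∀ y, pair (fun i => f (Pi.single i 1)) y = f y := by
    intro y
    have : y = y 0 • Pi.single 0 1 + y 1 • Pi.single 1 1 := by
      ext i; fin_cases i <;> simp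
    conv_rhs => rw [this]
    simp only [pair, map_add, map_smul, smul_eq_mul]
    ring
  refine Finset.mem_coe.2 (mem_exposed.2 ⟨fun i => f (Pi.single i 1), trivial, hvX,
    fun x hx hne => ?_⟩)
  rw [hval, hval]
  exact (hf x (subset_convexHull ℝ _ ⟨hx, hne⟩)).trans hu

/-! ### Orbits of two maps and the passage to vertex counts -/

/-- The points obtained from `a` by `k` applications of `f` or `g`. -/
noncomputable def orbit (f g : (Fin 2 → ℝ) → (Fin 2 → ℝ)) (a : Fin 2 → ℝ) :
    ℕ → Finset (Fin 2 → ℝ)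
  | 0 => {a}
  | k + 1 => (orbit f g a k).image f ∪ (orbit f g a k).image g

variable {f g : (Fin 2 → ℝ) → (Fin 2 → ℝ)} {a : Fin 2 → ℝ} {k : ℕ}

lemma mem_orbit_succ :
    x ∈ orbit f g a (k + 1) ↔ ∃ w ∈ orbit f g a k, x = f w ∨ x = g w := by
  simp only [orbit, Finset.mem_union, Finset.mem_image]
  grind

lemma apply_left_mem_orbit (h : x ∈ orbit f g a k) : f x ∈ orbit f g a (k + 1) :=
  mem_orbit_succ.2 ⟨x, h, Or.inl rfl⟩

lemma apply_right_mem_orbit (h : x ∈ orbit f g a k) : g x ∈ orbit f g a (k + 1) :=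
  mem_orbit_succ.2 ⟨x, h, Or.inr rfl⟩

lemma trajectory_congr {n : ℕ} {T T' : ℕ → Matrix (Fin n) (Fin n) ℝ} (b : Fin n → ℝ) :
    ∀ k : ℕ, (∀ j < k, T j = T' j) → trajectory T b k = trajectory T' b k
  | 0, _ => rfl
  | k + 1, h => by
    simp only [trajectory]
    rw [h k k.lt_succ_self, trajectory_congr b k fun j hj => h j (hj.trans k.lt_succ_self)]

lemma endpoints_pair (A B : Matrix (Fin 2) (Fin 2) ℝ) (a : Fin 2 → ℝ) (k : ℕ) :
    endpoints {A, B} a k = orbit (A *ᵥ ·) (B *ᵥ ·) a k := by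
  induction k with
  | zero =>
    ext x
    simp only [endpoints, orbit, Set.mem_ofPred_eq, trajectory, Finset.coe_singleton,
      Set.mem_singleton_iff]
    exact ⟨fun ⟨_, _, h⟩ => h, fun h => ⟨fun _ => A, by simp, h⟩⟩
  | succ k ih =>
    ext x
    rw [Finset.mem_coe, mem_orbit_succ]
    constructor
    · rintro ⟨T, hT, rfl⟩
      refine ⟨trajectory T a k, ?_, ?_⟩
      · rw [← Finset.mem_coe, ← ih]
        exact ⟨T, fun j hj => hT j (hj.trans k.lt_succ_self), rfl⟩
      · rcases hT k k.lt_succ_self with h | h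
        · left; simp [trajectory, h]
        · right
          rw [Set.mem_singleton_iff] at h
          simp [trajectory, h]
    · rintro ⟨w, hw, hx⟩
      rw [← Finset.mem_coe, ← ih] at hw
      obtain ⟨T, hT, rfl⟩ := hw
      have key : ∀ C ∈ ({A, B} : Set (Matrix (Fin 2) (Fin 2) ℝ)),
          C *ᵥ trajectory T a k ∈ endpoints {A, B} a (k + 1) := by
        intro C hC
        refine ⟨Function.update T k C, fun j hj => ?_, ?_⟩
        · rcases eq_or_ne j k with rfl | hne
          · simpa using hC
          · rw [Function.update_of_ne hne]
            exact hT j (by omega)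
        · simp only [trajectory, Function.update_self]
          rw [trajectory_congr a k fun j hj => ?_]
          rw [Function.update_of_ne hj.ne]
      rcases hx with rfl | rfl
      · exact key A (by simp)
      · exact key B (by simp)

/-- Polynomial bounds on the number of exposed points give bounds on the number of vertices. -/
lemma numExtremeIsBigOPow_of_card_le {A B : Matrix (Fin 2) (Fin 2) ℝ}
    (hf : ∀ x, A *ᵥ x = f x) (hg : ∀ x, B *ᵥ x = g x) {C n : ℕ} (d : ℝ) (hd : d = n) (hC : 0 < C)
    (h : ∀ a k, 0 < k → (exposed Set.univ (orbit f g a k)).card ≤ C * k ^ n) :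
    NumExtremeIsBigOPow {A, B} d := by
  subst hd
  refine ⟨C, by exact_mod_cast hC, 1, one_pos, fun k hk => ?_⟩
  have hN : numExtreme {A, B} k ≤ ((C * k ^ n : ℕ) : ℕ∞) := by
    refine iSup_le fun a => ?_
    have e₁ : (A *ᵥ ·) = f := funext hf
    have e₂ : (B *ᵥ ·) = g := funext hg
    rw [numExtremeFrom, polytope, endpoints_pair, e₁, e₂]
    refine (Set.encard_le_encard extremePoints_convexHull_subset_exposed).trans ?_
    rw [Set.encard_coe_eq_coe_finsetCard]
    exact_mod_cast h a k hk
  have hcast : ENNReal.ofReal ((C : ℝ) * (k : ℝ) ^ (n : ℝ)) = (((C * k ^ n : ℕ) : ℕ∞) : ℝ≥0∞) := by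
    rw [Real.rpow_natCast]
    have : (C : ℝ) * (k : ℝ) ^ n = ((C * k ^ n : ℕ) : ℝ) := by push_cast; ring
    rw [this, ENNReal.ofReal_natCast]
    simp
  rw [hcast]
  exact_mod_cast hN

lemma orbit_neg (hf : ∀ x, f (-x) = -f x) (hg : ∀ x, g (-x) = -g x) (a : Fin 2 → ℝ) (k : ℕ) :
    -x ∈ orbit f g (-a) k ↔ x ∈ orbit f g a k := by
  induction k generalizing x with
  | zero => simp [orbit]
  | succ k ih =>
    simp only [mem_orbit_succ]
    constructor
    · rintro ⟨w, hw, h⟩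
      refine ⟨-w, ih.1 (by simpa using hw), ?_⟩
      rw [hf, hg]
      exact h.imp (fun h => by rw [← h, neg_neg]) (fun h => by rw [← h, neg_neg])
    · rintro ⟨w, hw, h⟩
      refine ⟨-w, ih.2 hw, ?_⟩
      rw [hf, hg]
      exact h.imp (fun h => by rw [h]) (fun h => by rw [h])

lemma neg_mem_exposed_orbit (hf : ∀ x, f (-x) = -f x) (hg : ∀ x, g (-x) = -g x)
    (h : v ∈ exposed (-K) (orbit f g a k)) : -v ∈ exposed K (orbit f g (-a) k) := by
  obtain ⟨c, hc, h⟩ := mem_exposed.1 h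
  refine mem_exposed.2 ⟨-c, hc, (orbit_neg hf hg a k).2 h.1, fun x hx hne => ?_⟩
  have := h.2 (-x) ((orbit_neg hf hg a k).1 (by simpa using hx)) (by rintro rfl; simp at hne)
  simp only [pair, Pi.neg_apply] at this ⊢
  linarith

/-- Negation turns `-K` into `K` at the price of starting from `-a`; this is free for bounds uniform
in the initial vector. -/
lemma card_exposed_neg_orbit_le (hf : ∀ x, f (-x) = -f x) (hg : ∀ x, g (-x) = -g x) :
    (exposed (-K) (orbit f g a k)).card ≤ (exposed K (orbit f g (-a) k)).card :=
  Finset.card_le_card_of_injOn (-·) (fun _ hv => neg_mem_exposed_orbit hf hg hv)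
    neg_injective.injOn

/-! ### Shears, the swap and mixed vectors -/

/-- The action of `!![1, 1; 0, 1]`. -/
def shearU (v : Fin 2 → ℝ) : Fin 2 → ℝ := ![v 0 + v 1, v 1]

/-- The action of `!![1, 0; 1, 1]`. -/
def shearL (v : Fin 2 → ℝ) : Fin 2 → ℝ := ![v 0, v 0 + v 1]

/-- The action of `!![0, 1; 1, 0]`. -/
def swap (v : Fin 2 → ℝ) : Fin 2 → ℝ := ![v 1, v 0]

@[simp] lemma shearU_zero (v : Fin 2 → ℝ) : shearU v 0 = v 0 + v 1 := rfl
@[simp] lemma shearU_one (v : Fin 2 → ℝ) : shearU v 1 = v 1 := rfl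
@[simp] lemma shearL_zero (v : Fin 2 → ℝ) : shearL v 0 = v 0 := rfl
@[simp] lemma shearL_one (v : Fin 2 → ℝ) : shearL v 1 = v 0 + v 1 := rfl
@[simp] lemma swap_zero (v : Fin 2 → ℝ) : swap v 0 = v 1 := rfl
@[simp] lemma swap_one (v : Fin 2 → ℝ) : swap v 1 = v 0 := rfl

lemma vec_ext (h0 : v 0 = w 0) (h1 : v 1 = w 1) : v = w := by
  ext i
  fin_cases i
  exacts [h0, h1]

lemma swap_swap (v : Fin 2 → ℝ) : swap (swap v) = v := vec_ext rfl rfl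

lemma swap_shearU (v : Fin 2 → ℝ) : swap (shearU v) = shearL (swap v) :=
  vec_ext rfl (add_comm _ _)

lemma swap_shearL (v : Fin 2 → ℝ) : swap (shearL v) = shearU (swap v) :=
  vec_ext (add_comm _ _) rfl

lemma shearU_neg (v : Fin 2 → ℝ) : shearU (-v) = -shearU v := vec_ext (by simp; ring) rfl
lemma shearL_neg (v : Fin 2 → ℝ) : shearL (-v) = -shearL v := vec_ext rfl (by simp; ring)
lemma swap_neg (v : Fin 2 → ℝ) : swap (-v) = -swap v := vec_ext rfl rfl

lemma swap_injective : swap.Injective := fun v w h => by rw [← swap_swap v, h, swap_swap]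

lemma shearU_injective : shearU.Injective := fun v w h => by
  have h0 := congrFun h 0
  have h1 := congrFun h 1
  simp only [shearU_zero, shearU_one] at h0 h1
  exact vec_ext (by linarith) h1

lemma shearL_injective : shearL.Injective := fun v w h => by
  have h0 := congrFun h 0
  have h1 := congrFun h 1
  simp only [shearL_zero, shearL_one] at h0 h1
  exact vec_ext h0 (by linarith)

lemma pair_shearU (c x : Fin 2 → ℝ) : pair c (shearU x) = pair (shearL c) x := by
  simp [pair]; ring

lemma pair_shearL (c x : Fin 2 → ℝ) : pair c (shearL x) = pair (shearU c) x := by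
  simp [pair]; ring

lemma pair_swap (c x : Fin 2 → ℝ) : pair c (swap x) = pair (swap c) x := by
  simp [pair]; ring

/-- The vector lies outside the closed nonnegative and nonpositive quadrants. -/
def IsMixed (v : Fin 2 → ℝ) : Prop := v 0 * v 1 < 0

lemma nonneg_or_nonpos_of_not_isMixed (h : ¬IsMixed v) :
    (0 ≤ v 0 ∧ 0 ≤ v 1) ∨ (v 0 ≤ 0 ∧ v 1 ≤ 0) :=
  mul_nonneg_iff.1 (not_lt.1 h)

lemma isMixed_iff : IsMixed v ↔ (0 < v 0 ∧ v 1 < 0) ∨ (v 0 < 0 ∧ 0 < v 1) := mul_neg_iff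

lemma IsMixed.of_shearU (h : IsMixed (shearU v)) : IsMixed v := by
  by_contra hv
  rcases nonneg_or_nonpos_of_not_isMixed hv with ⟨h0, h1⟩ | ⟨h0, h1⟩ <;>
  · simp only [isMixed_iff, shearU_zero, shearU_one] at h
    grind

lemma IsMixed.of_shearL (h : IsMixed (shearL v)) : IsMixed v := by
  by_contra hv
  rcases nonneg_or_nonpos_of_not_isMixed hv with ⟨h0, h1⟩ | ⟨h0, h1⟩ <;>
  · simp only [isMixed_iff, shearL_zero, shearL_one] at h
    grind

lemma isMixed_swap : IsMixed (swap v) ↔ IsMixed v := by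
  rw [IsMixed, IsMixed, swap_zero, swap_one, mul_comm]

/-- The sum of the coordinates would have sign opposite to both coordinates, which themselves have
opposite signs. -/
lemma not_isMixed_shearU_shearL (hU : IsMixed (shearU v)) (hL : IsMixed (shearL v)) : False := by
  have h := hU.of_shearU
  simp only [isMixed_iff, shearL_zero, shearL_one, shearU_zero, shearU_one] at h hU hL
  grind

/-! ### The pair of shears -/

lemma shearL_mem_posCone (hc : c ∈ posCone) : shearL c ∈ posCone := by
  simp only [posCone, Set.mem_ofPred_eq, shearL_zero, shearL_one] at hc ⊢
  grind

lemma shearU_mem_posCone (hc : c ∈ posCone) : shearU c ∈ posCone := by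
  simp only [posCone, Set.mem_ofPred_eq, shearU_zero, shearU_one] at hc ⊢
  grind

lemma card_exposed_posCone_shears (a : Fin 2 → ℝ) (k : ℕ) :
    (exposed posCone (orbit shearU shearL a k)).card ≤ k + 1 := by
  induction k with
  | zero => exact (Finset.card_le_card exposed_subset).trans (by simp [orbit])
  | succ k ih =>
    have hsub : exposed posCone (orbit shearU shearL a (k + 1)) ⊆
        (exposed (posCone ∩ {c | c 0 ≤ c 1}) (orbit shearU shearL a k)).image shearU ∪
        (exposed (posCone ∩ {c | c 1 ≤ c 0}) (orbit shearU shearL a k)).image shearL := by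
      intro v hv
      obtain ⟨c, hc, h⟩ := mem_exposed.1 hv
      obtain ⟨w, hw, rfl | rfl⟩ := mem_orbit_succ.1 h.1
      · refine Finset.mem_union_left _ (Finset.mem_image_of_mem _ (mem_exposed.2 ⟨_, ⟨?_, ?_⟩,
          h.of_map shearU_injective pair_shearU (fun _ => apply_left_mem_orbit) hw⟩))
        · exact shearL_mem_posCone hc
        · simpa using hc.2.1
      · refine Finset.mem_union_right _ (Finset.mem_image_of_mem _ (mem_exposed.2 ⟨_, ⟨?_, ?_⟩,
          h.of_map shearL_injective pair_shearL (fun _ => apply_right_mem_orbit) hw⟩))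
        · exact shearU_mem_posCone hc
        · simpa using hc.1
    have hsplit := card_exposed_add_le (K := posCone) (K₁ := posCone ∩ {c | c 0 ≤ c 1})
      (K₂ := posCone ∩ {c | c 1 ≤ c 0}) (X := orbit shearU shearL a k) (e := ![1, 1])
      Set.inter_subset_left Set.inter_subset_left (by
        rintro c₁ ⟨⟨h0, h1, h2⟩, h3⟩ c₂ ⟨⟨h0', h1', h2'⟩, h3'⟩
        simp only [Set.mem_ofPred_eq] at h3 h3'
        rcases h3.eq_or_lt with heq | hlt
        · exact ⟨1, 0, c₁ 0, by simp, by simp, by simp, by linarith,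
            vec_ext (by simp) (by simp [heq])⟩
        -- These weights cancel `c 1 - c 0`, putting the combination on the diagonal ray. They could
        -- both vanish if `c₁` were diagonal, hence the separate case.
        · exact ⟨c₂ 0 - c₂ 1, c₁ 1 - c₁ 0, c₁ 1 * c₂ 0 - c₁ 0 * c₂ 1, by linarith, by linarith,
            by linarith, by nlinarith, vec_ext (by simp; ring) (by simp; ring)⟩)
    have h1 := (Finset.card_le_card hsub).trans (Finset.card_union_le _ _)
    have h2 := Finset.card_image_le (f := shearU)
      (s := exposed (posCone ∩ {c | c 0 ≤ c 1}) (orbit shearU shearL a k))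
    have h3 := Finset.card_image_le (f := shearL)
      (s := exposed (posCone ∩ {c | c 1 ≤ c 0}) (orbit shearU shearL a k))
    omega

/-- Mixed vectors have only mixed predecessors, and at most one shear keeps a given vector mixed, so
the mixed points never branch. -/
lemma eq_of_isMixed_of_mem_orbit_shears (hv : v ∈ orbit shearU shearL a k)
    (hw : w ∈ orbit shearU shearL a k) (hv' : IsMixed v) (hw' : IsMixed w) : v = w := by
  induction k generalizing v w with
  | zero =>
    simp only [orbit, Finset.mem_singleton] at hv hw
    rw [hv, hw]
  | succ k ih =>
    obtain ⟨x, hx, rfl | rfl⟩ := mem_orbit_succ.1 hv <;>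
    obtain ⟨y, hy, rfl | rfl⟩ := mem_orbit_succ.1 hw
    · rw [ih hx hy hv'.of_shearU hw'.of_shearU]
    · rw [ih hx hy hv'.of_shearU hw'.of_shearL] at hv'
      exact (not_isMixed_shearU_shearL hv' hw').elim
    · rw [ih hx hy hv'.of_shearL hw'.of_shearU] at hv'
      exact (not_isMixed_shearU_shearL hw' hv').elim
    · rw [ih hx hy hv'.of_shearL hw'.of_shearL]

open Classical in
/-- The points of `X` outside the closed nonnegative and nonpositive quadrants. -/
noncomputable def mixedPart (X : Finset (Fin 2 → ℝ)) : Finset (Fin 2 → ℝ) := X.filter IsMixed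

lemma mem_mixedPart : v ∈ mixedPart X ↔ v ∈ X ∧ IsMixed v := by simp [mixedPart]

open Classical in
-- The sign of `c 0 * w 1 - c 1 * w 0` decides which shear of `w` wins, and for `c` in `mixCone` it
-- is fixed on each closed quadrant of constant sign. Each such `w` therefore needs one image only.
lemma card_exposed_mixCone_shears_succ (a : Fin 2 → ℝ) (k : ℕ) :
    (exposed mixCone (orbit shearU shearL a (k + 1))).card ≤
      (exposed mixCone (orbit shearU shearL a k)).card + 2 * k + 3 := by
  set X := orbit shearU shearL a k
  -- The preferred shear on nonnegative and nonpositive points. Mixed points default to `shearL`;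
  -- their `shearU` images are counted separately.
  set φ : (Fin 2 → ℝ) → (Fin 2 → ℝ) := fun w => if 0 ≤ w 0 ∧ 0 ≤ w 1 then shearU w else shearL w
  have hsub : exposed mixCone (orbit shearU shearL a (k + 1)) ⊆
      (exposed (mixCone ∪ (posCone ∪ -posCone)) X).image φ ∪ (mixedPart X).image shearU := by
    intro v hv
    obtain ⟨c, hc, h⟩ := mem_exposed.1 hv
    obtain ⟨w, hw, hvw⟩ := mem_orbit_succ.1 h.1
    have hU : shearL c ∈ mixCone ∪ (posCone ∪ -posCone) := by
      simp only [mixCone, posCone, Set.mem_union, Set.mem_neg, Set.mem_ofPred_eq, shearL_zero,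
        shearL_one, Pi.neg_apply] at hc ⊢
      grind
    have hL : shearU c ∈ mixCone ∪ (posCone ∪ -posCone) := by
      simp only [mixCone, posCone, Set.mem_union, Set.mem_neg, Set.mem_ofPred_eq, shearU_zero,
        shearU_one, Pi.neg_apply] at hc ⊢
      grind
    have hdiff : pair c (shearU w) - pair c (shearL w) = c 0 * w 1 - c 1 * w 0 := by
      simp [pair]; ring
    have hexp : w ∈ exposed (mixCone ∪ (posCone ∪ -posCone)) X := by
      rcases hvw with rfl | rfl
      · exact mem_exposed.2 ⟨_, hU,
          h.of_map shearU_injective pair_shearU (fun _ => apply_left_mem_orbit) hw⟩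
      · exact mem_exposed.2 ⟨_, hL,
          h.of_map shearL_injective pair_shearL (fun _ => apply_right_mem_orbit) hw⟩
    by_cases hn : 0 ≤ w 0 ∧ 0 ≤ w 1
    · refine Finset.mem_union_left _ (Finset.mem_image.2 ⟨w, hexp, ?_⟩)
      simp only [φ, if_pos hn]
      rcases hvw with rfl | rfl
      · rfl
      · refine h.eq_of_le (apply_left_mem_orbit hw) ?_
        nlinarith [mul_nonneg hc.1.le hn.2, mul_nonneg (neg_nonneg.2 hc.2.le) hn.1]
    · rcases hvw with rfl | rfl
      · by_cases hm : IsMixed w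
        · exact Finset.mem_union_right _
            (Finset.mem_image_of_mem _ (mem_mixedPart.2 ⟨hw, hm⟩))
        · obtain hp | hp := nonneg_or_nonpos_of_not_isMixed hm
          · exact (hn hp).elim
          refine Finset.mem_union_left _ (Finset.mem_image.2 ⟨w, hexp, ?_⟩)
          simp only [φ, if_neg hn]
          refine h.eq_of_le (apply_right_mem_orbit hw) ?_
          nlinarith [mul_nonneg hc.1.le (neg_nonneg.2 hp.2),
            mul_nonneg (neg_nonneg.2 hc.2.le) (neg_nonneg.2 hp.1)]
      · exact Finset.mem_union_left _ (Finset.mem_image.2 ⟨w, hexp, by simp only [φ, if_neg hn]⟩)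
  have hm : (mixedPart X).card ≤ 1 := Finset.card_le_one.2 fun v hv w hw =>
    eq_of_isMixed_of_mem_orbit_shears (mem_mixedPart.1 hv).1 (mem_mixedPart.1 hw).1
      (mem_mixedPart.1 hv).2 (mem_mixedPart.1 hw).2
  have h1 := (Finset.card_le_card hsub).trans (Finset.card_union_le _ _)
  have h2 := (Finset.card_image_le (f := φ)
    (s := exposed (mixCone ∪ (posCone ∪ -posCone)) X)).trans (card_exposed_union_le.trans
      (add_le_add_right card_exposed_union_le _))
  have h3 := Finset.card_image_le (f := shearU) (s := mixedPart X)
  have h4 : (exposed posCone X).card ≤ k + 1 := card_exposed_posCone_shears a k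
  have h5 : (exposed (-posCone) X).card ≤ k + 1 :=
    (card_exposed_neg_orbit_le shearU_neg shearL_neg).trans (card_exposed_posCone_shears (-a) k)
  omega

lemma card_exposed_mixCone_shears (a : Fin 2 → ℝ) (k : ℕ) :
    (exposed mixCone (orbit shearU shearL a k)).card ≤ (k + 1) ^ 2 := by
  induction k with
  | zero => exact (Finset.card_le_card exposed_subset).trans (by simp [orbit])
  | succ k ih =>
    have := card_exposed_mixCone_shears_succ a k
    nlinarith

lemma card_exposed_shears (a : Fin 2 → ℝ) (k : ℕ) :
    (exposed Set.univ (orbit shearU shearL a k)).card ≤ 4 * (k + 1) ^ 2 := by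
  have h0 := card_exposed_univ_le (X := orbit shearU shearL a k)
  have h1 := card_exposed_posCone_shears a k
  have h2 := card_exposed_mixCone_shears a k
  have h3 := (card_exposed_neg_orbit_le (K := posCone) (a := a) (k := k) shearU_neg
    shearL_neg).trans (card_exposed_posCone_shears (-a) k)
  have h4 := (card_exposed_neg_orbit_le (K := mixCone) (a := a) (k := k) shearU_neg
    shearL_neg).trans (card_exposed_mixCone_shears (-a) k)
  nlinarith

/-! ### The swap and its product with a shear -/

/-- The two images of `w` agree in the second coordinate and differ by `w 0` in the first, so the
sign of `m 0` tells which image of the old greatest point is the new one. -/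
lemma exists_max_orbit_swap_shearU_swap (a : Fin 2 → ℝ) (k : ℕ) :
    ∃ m ∈ orbit swap (shearU ∘ swap) a k, ∀ x ∈ orbit swap (shearU ∘ swap) a k,
      x 0 ≤ m 0 ∧ x 1 ≤ m 1 := by
  induction k with
  | zero => exact ⟨a, by simp [orbit], by simp [orbit]⟩
  | succ k ih =>
    obtain ⟨m, hm, hmax⟩ := ih
    rcases le_total 0 (m 0) with h | h
    · refine ⟨_, apply_right_mem_orbit hm, fun x hx => ?_⟩
      obtain ⟨w, hw, rfl | rfl⟩ := mem_orbit_succ.1 hx <;>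
      · have := hmax w hw
        simp only [Function.comp_apply, shearU_zero, shearU_one, swap_zero, swap_one]
        constructor <;> linarith
    · refine ⟨_, apply_left_mem_orbit hm, fun x hx => ?_⟩
      obtain ⟨w, hw, rfl | rfl⟩ := mem_orbit_succ.1 hx <;>
      · have := hmax w hw
        simp only [Function.comp_apply, shearU_zero, shearU_one, swap_zero, swap_one]
        constructor <;> linarith

lemma card_exposed_posCone_swap_shearU_swap (a : Fin 2 → ℝ) (k : ℕ) :
    (exposed posCone (orbit swap (shearU ∘ swap) a k)).card ≤ 1 := by
  obtain ⟨m, hm, hmax⟩ := exists_max_orbit_swap_shearU_swap a k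
  have key : ∀ v ∈ exposed posCone (orbit swap (shearU ∘ swap) a k), v = m := by
    intro v hv
    obtain ⟨c, hc, h⟩ := mem_exposed.1 hv
    refine (h.eq_of_le hm ?_).symm
    have := hmax v h.1
    exact add_le_add (mul_le_mul_of_nonneg_left this.1 hc.1)
      (mul_le_mul_of_nonneg_left this.2 hc.2.1)
  exact Finset.card_le_one.2 fun v hv w hw => (key v hv).trans (key w hw).symm

lemma swap_comp_neg (v : Fin 2 → ℝ) : (shearU ∘ swap) (-v) = -(shearU ∘ swap) v := by
  simp only [Function.comp_apply, swap_neg, shearU_neg]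

open Classical in
-- The values at the two images differ by `c 0 * w 0`, so the sign of `w 0` alone selects the image.
-- The transposes send `mixCone` into `-mixCone ∪ posCone`, and `posCone` exposes at most one point.
lemma card_exposed_mixCone_swap_shearU_swap (a : Fin 2 → ℝ) (k : ℕ) :
    (exposed mixCone (orbit swap (shearU ∘ swap) a k)).card ≤ k + 1 := by
  induction k generalizing a with
  | zero => exact (Finset.card_le_card exposed_subset).trans (by simp [orbit])
  | succ k ih =>
    set X := orbit swap (shearU ∘ swap) a k
    set φ : (Fin 2 → ℝ) → (Fin 2 → ℝ) := fun w => if 0 ≤ w 0 then shearU (swap w) else swap w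
    have hsub : exposed mixCone (orbit swap (shearU ∘ swap) a (k + 1)) ⊆
        (exposed (-mixCone ∪ posCone) X).image φ := by
      intro v hv
      obtain ⟨c, hc, h⟩ := mem_exposed.1 hv
      obtain ⟨w, hw, hvw⟩ := mem_orbit_succ.1 h.1
      have hdiff : pair c (shearU (swap w)) - pair c (swap w) = c 0 * w 0 := by
        simp [pair]; ring
      refine Finset.mem_image.2 ⟨w, ?_, ?_⟩
      · rcases hvw with rfl | rfl
        · refine mem_exposed.2 ⟨_, Or.inl ?_,
            h.of_map swap_injective pair_swap (fun _ => apply_left_mem_orbit) hw⟩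
          simpa [mixCone, and_comm] using hc
        · refine mem_exposed.2 ⟨_, ?_, h.of_map (T' := swap ∘ shearL)
            (shearU_injective.comp swap_injective)
            (fun c x => by simp only [Function.comp_apply, pair_shearU, pair_swap])
            (fun _ => apply_right_mem_orbit) hw⟩
          simp only [mixCone, posCone, Set.mem_union, Set.mem_neg, Set.mem_ofPred_eq, shearL_zero,
            shearL_one, swap_zero, swap_one, Function.comp_apply, Pi.neg_apply] at hc ⊢
          grind
      · by_cases hn : 0 ≤ w 0
        · simp only [φ, if_pos hn]
          refine h.eq_of_le (apply_right_mem_orbit hw) ?_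
          rcases hvw with rfl | rfl
          · nlinarith [mul_nonneg hc.1.le hn]
          · exact le_rfl
        · simp only [φ, if_neg hn]
          refine h.eq_of_le (apply_left_mem_orbit hw) ?_
          rcases hvw with rfl | rfl
          · exact le_rfl
          · simp only [Function.comp_apply]
            nlinarith [mul_nonneg hc.1.le (neg_nonneg.2 (not_le.1 hn).le)]
    have h1 := (Finset.card_le_card hsub).trans (Finset.card_image_le.trans card_exposed_union_le)
    have h2 : (exposed (-mixCone) X).card ≤ k + 1 :=
      (card_exposed_neg_orbit_le swap_neg swap_comp_neg).trans (ih (-a))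
    have h3 : (exposed posCone X).card ≤ 1 := card_exposed_posCone_swap_shearU_swap a k
    omega

lemma card_exposed_swap_shearU_swap (a : Fin 2 → ℝ) (k : ℕ) :
    (exposed Set.univ (orbit swap (shearU ∘ swap) a k)).card ≤ 2 * k + 4 := by
  have h0 := card_exposed_univ_le (X := orbit swap (shearU ∘ swap) a k)
  have h1 := card_exposed_posCone_swap_shearU_swap a k
  have h2 := card_exposed_mixCone_swap_shearU_swap a k
  have h3 := (card_exposed_neg_orbit_le (K := posCone) (a := a) (k := k) swap_neg
    swap_comp_neg).trans (card_exposed_posCone_swap_shearU_swap (-a) k)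
  have h4 := (card_exposed_neg_orbit_le (K := mixCone) (a := a) (k := k) swap_neg
    swap_comp_neg).trans (card_exposed_mixCone_swap_shearU_swap (-a) k)
  omega

/-! ### The swap and a shear -/

lemma orbit_swap_shearU_mono (h : x ∈ orbit swap shearU a k) :
    x ∈ orbit swap shearU a (k + 2) := by
  simpa only [swap_swap] using apply_left_mem_orbit (g := shearU) (apply_left_mem_orbit h)

/-- Two consecutive swaps cancel and orbits increase in steps of two, so double swaps applied last
can be stripped until a shear appears or only swaps remain. -/
lemma orbit_swap_shearU_cases (k : ℕ) (hx : x ∈ orbit swap shearU a (k + 2)) :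
    (∃ w ∈ orbit swap shearU a (k + 1), x = shearU w) ∨
      (∃ w ∈ orbit swap shearU a k, x = swap (shearU w)) ∨ x = swap^[k + 2] a := by
  induction k using Nat.twoStepInduction generalizing x with
  | zero =>
    obtain ⟨w, hw, rfl | rfl⟩ := mem_orbit_succ.1 hx
    · obtain ⟨y, hy, rfl | rfl⟩ := mem_orbit_succ.1 hw
      · simp only [orbit, Finset.mem_singleton] at hy
        subst hy
        exact Or.inr (Or.inr rfl)
      · exact Or.inr (Or.inl ⟨y, hy, rfl⟩)
    · exact Or.inl ⟨w, hw, rfl⟩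
  | one =>
    obtain ⟨w, hw, rfl | rfl⟩ := mem_orbit_succ.1 hx
    · obtain ⟨y, hy, rfl | rfl⟩ := mem_orbit_succ.1 hw
      · obtain ⟨z, hz, rfl | rfl⟩ := mem_orbit_succ.1 hy
        · simp only [orbit, Finset.mem_singleton] at hz
          subst hz
          exact Or.inr (Or.inr rfl)
        · exact Or.inl ⟨z, orbit_swap_shearU_mono hz, swap_swap _⟩
      · exact Or.inr (Or.inl ⟨y, hy, rfl⟩)
    · exact Or.inl ⟨w, hw, rfl⟩
  | more n ih _ =>
    obtain ⟨w, hw, rfl | rfl⟩ := mem_orbit_succ.1 hx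
    · obtain ⟨y, hy, rfl | rfl⟩ := mem_orbit_succ.1 hw
      · rw [swap_swap]
        rcases ih hy with ⟨z, hz, h⟩ | ⟨z, hz, h⟩ | h
        · exact Or.inl ⟨z, orbit_swap_shearU_mono hz, h⟩
        · exact Or.inr (Or.inl ⟨z, orbit_swap_shearU_mono hz, h⟩)
        · refine Or.inr (Or.inr ?_)
          rw [Function.iterate_succ_apply', Function.iterate_succ_apply', swap_swap, h]
      · exact Or.inr (Or.inl ⟨y, hy, rfl⟩)
    · exact Or.inl ⟨w, hw, rfl⟩

lemma swap_comp_shearU_injective : (swap ∘ shearU).Injective :=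
  swap_injective.comp shearU_injective

lemma pair_swap_comp_shearU (c x : Fin 2 → ℝ) :
    pair c ((swap ∘ shearU) x) = pair ((shearL ∘ swap) c) x := by
  simp only [Function.comp_apply, pair_swap, pair_shearU]

/-- Functionals in `K` see a level of the orbit of the swap and a shear through the two
preceding levels. -/
lemma card_exposed_swap_shearU_le {K K₁ K₂ : Set (Fin 2 → ℝ)} (h₁ : ∀ c ∈ K, shearL c ∈ K₁)
    (h₂ : ∀ c ∈ K, shearL (swap c) ∈ K₂) (a : Fin 2 → ℝ) (k : ℕ) :
    (exposed K (orbit swap shearU a (k + 2))).card ≤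
      (exposed K₁ (orbit swap shearU a (k + 1))).card +
        (exposed K₂ (orbit swap shearU a k)).card + 1 := by
  have hsub : exposed K (orbit swap shearU a (k + 2)) ⊆
      (exposed K₁ (orbit swap shearU a (k + 1))).image shearU ∪
        (exposed K₂ (orbit swap shearU a k)).image (swap ∘ shearU) ∪ {swap^[k + 2] a} := by
    intro v hv
    obtain ⟨c, hc, h⟩ := mem_exposed.1 hv
    rcases orbit_swap_shearU_cases k h.1 with ⟨w, hw, rfl⟩ | ⟨w, hw, rfl⟩ | rfl
    · exact Finset.mem_union_left _ (Finset.mem_union_left _ (Finset.mem_image_of_mem _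
        (mem_exposed.2 ⟨_, h₁ c hc,
          h.of_map shearU_injective pair_shearU (fun _ => apply_right_mem_orbit) hw⟩)))
    · have he := Exposes.of_map (T := swap ∘ shearU) swap_comp_shearU_injective
        pair_swap_comp_shearU (X := orbit swap shearU a k) (Y := orbit swap shearU a (k + 2))
        (fun _ hx => apply_left_mem_orbit (apply_right_mem_orbit hx)) hw h
      exact Finset.mem_union_left _ (Finset.mem_union_right _ (Finset.mem_image.2
        ⟨w, mem_exposed.2 ⟨_, h₂ c hc, he⟩, rfl⟩))
    · simp
  refine (Finset.card_le_card hsub).trans ((Finset.card_union_le _ _).trans ?_)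
  exact add_le_add ((Finset.card_union_le _ _).trans
    (add_le_add Finset.card_image_le Finset.card_image_le)) (by simp)

lemma card_exposed_orbit_zero_le {f g : (Fin 2 → ℝ) → (Fin 2 → ℝ)} (K : Set (Fin 2 → ℝ)) :
    (exposed K (orbit f g a 0)).card ≤ 1 :=
  (Finset.card_le_card exposed_subset).trans (by simp [orbit])

lemma card_exposed_orbit_one_le {f g : (Fin 2 → ℝ) → (Fin 2 → ℝ)} (K : Set (Fin 2 → ℝ)) :
    (exposed K (orbit f g a 1)).card ≤ 2 :=
  (Finset.card_le_card exposed_subset).trans ((Finset.card_union_le _ _).trans (by simp [orbit]))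

/-- The half-cone is cut along the ray of `![1, 2]`: the two transposes land on the two sides.
Carrying the narrow cone at the preceding level along makes the two-level recursion telescope, with
increment two, where a naive bound would grow like Fibonacci numbers. -/
lemma card_exposed_halfCone_swap_shearU (a : Fin 2 → ℝ) (k : ℕ) :
    (exposed (posCone ∩ {c | c 0 ≤ c 1}) (orbit swap shearU a (k + 1))).card +
      (exposed (posCone ∩ {c | c 0 ≤ c 1 ∧ c 1 ≤ 2 * c 0}) (orbit swap shearU a k)).card ≤
        2 * k + 3 := by
  induction k with
  | zero =>
    have h1 := card_exposed_orbit_zero_le (f := swap) (g := shearU) (a := a)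
      (posCone ∩ {c | c 0 ≤ c 1 ∧ c 1 ≤ 2 * c 0})
    have h2 := card_exposed_orbit_one_le (f := swap) (g := shearU) (a := a)
      (posCone ∩ {c | c 0 ≤ c 1})
    simp only [zero_add]
    omega
  | succ k ih =>
    have h1 := card_exposed_swap_shearU_le (K := posCone ∩ {c | c 0 ≤ c 1})
      (K₁ := posCone ∩ {c | 2 * c 0 ≤ c 1}) (K₂ := posCone ∩ {c | c 0 ≤ c 1 ∧ c 1 ≤ 2 * c 0})
      (by
        rintro c ⟨hc, hc'⟩
        refine ⟨shearL_mem_posCone hc, ?_⟩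
        simp only [Set.mem_ofPred_eq, shearL_zero, shearL_one] at hc' ⊢
        linarith)
      (by
        rintro c ⟨⟨h0, h1, h2⟩, hc'⟩
        simp only [Set.mem_ofPred_eq] at hc'
        simp only [posCone, Set.mem_inter_iff, Set.mem_ofPred_eq, shearL_zero, shearL_one,
          swap_zero, swap_one]
        grind) a k
    have h2 := card_exposed_add_le (K := posCone ∩ {c | c 0 ≤ c 1})
      (K₁ := posCone ∩ {c | 2 * c 0 ≤ c 1}) (K₂ := posCone ∩ {c | c 0 ≤ c 1 ∧ c 1 ≤ 2 * c 0})
      (X := orbit swap shearU a (k + 1)) (e := ![1, 2])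
      (by
        rintro c ⟨⟨h0, h1, h2⟩, hc'⟩
        refine ⟨⟨h0, h1, h2⟩, ?_⟩
        simp only [Set.mem_ofPred_eq] at hc' ⊢
        linarith)
      (by
        rintro c ⟨hc, hc'⟩
        exact ⟨hc, hc'.1⟩)
      (by
        rintro c₁ ⟨⟨h0, h1, h2⟩, h3⟩ c₂ ⟨⟨h0', h1', h2'⟩, -, h3'⟩
        simp only [Set.mem_ofPred_eq] at h3 h3'
        rcases h3.eq_or_lt with heq | hlt
        · exact ⟨1, 0, c₁ 0, by simp, by simp, by simp, by linarith,
            vec_ext (by simp) (by simp [← heq, mul_comm])⟩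
        -- The weights cancel `c 1 - 2 * c 0`.
        · exact ⟨2 * c₂ 0 - c₂ 1, c₁ 1 - 2 * c₁ 0, c₁ 1 * c₂ 0 - c₁ 0 * c₂ 1, by linarith,
            by linarith, by linarith, by nlinarith, vec_ext (by simp; ring) (by simp; ring)⟩)
    rw [add_assoc k 1 1, one_add_one_eq_two]
    omega

lemma card_exposed_posCone_swap_shearU (a : Fin 2 → ℝ) (k : ℕ) :
    (exposed posCone (orbit swap shearU a k)).card ≤ 4 * k + 2 := by
  have hhalf : ∀ k, (exposed (posCone ∩ {c | c 0 ≤ c 1}) (orbit swap shearU a k)).card ≤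
      2 * k + 1 := by
    rintro (_ | k)
    · exact card_exposed_orbit_zero_le _
    · have := card_exposed_halfCone_swap_shearU a k
      omega
  rcases k with _ | _ | k
  · exact (card_exposed_orbit_zero_le _).trans (by norm_num)
  · exact (card_exposed_orbit_one_le _).trans (by norm_num)
  · have h := card_exposed_swap_shearU_le (K := posCone) (K₁ := posCone ∩ {c | c 0 ≤ c 1})
      (K₂ := posCone ∩ {c | c 0 ≤ c 1})
      (fun c hc => ⟨shearL_mem_posCone hc, by simpa using hc.2.1⟩)
      (fun c hc => ⟨shearL_mem_posCone ⟨hc.2.1, hc.1, by simpa [add_comm] using hc.2.2⟩,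
        by simpa using hc.1⟩) a k
    have h1 := hhalf k
    have h2 := hhalf (k + 1)
    rw [add_assoc k 1 1, one_add_one_eq_two]
    omega

/-! ### Mixed points and mixed functionals for the swap and a shear -/

open Classical in
/-- The shear that may keep a vector mixed. -/
noncomputable def mixedStep (v : Fin 2 → ℝ) : Fin 2 → ℝ :=
  -- In a tie neither shear keeps a mixed vector mixed, so the default `0` loses nothing; being
  -- fixed by the swap, it lets `mixedStep` commute with the swap.
  if |v 1| < |v 0| then shearU v else if |v 0| < |v 1| then shearL v else 0

lemma mixedStep_of_lt (h : |v 1| < |v 0|) : mixedStep v = shearU v := if_pos h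

lemma mixedStep_of_gt (h : |v 0| < |v 1|) : mixedStep v = shearL v := by
  rw [mixedStep, if_neg h.not_gt, if_pos h]

lemma mixedStep_of_eq (h : |v 0| = |v 1|) : mixedStep v = 0 := by
  rw [mixedStep, if_neg h.not_gt, if_neg h.not_lt]

lemma mixedStep_swap (v : Fin 2 → ℝ) : mixedStep (swap v) = swap (mixedStep v) := by
  rcases lt_trichotomy |v 0| |v 1| with h | h | h
  · rw [mixedStep_of_lt (v := swap v) h, mixedStep_of_gt h, swap_shearL]
  · rw [mixedStep_of_eq (v := swap v) h.symm, mixedStep_of_eq h]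
    exact vec_ext rfl rfl
  · rw [mixedStep_of_gt (v := swap v) h, mixedStep_of_lt h, swap_shearU]

lemma mixedStep_iterate_swap (n : ℕ) (v : Fin 2 → ℝ) :
    mixedStep^[n] (swap v) = swap (mixedStep^[n] v) :=
  (Function.Semiconj.iterate_right (f := swap) (ga := mixedStep) (gb := mixedStep)
    (fun v => (mixedStep_swap v).symm) n v).symm

lemma mixedStep_eq_shearU (h : IsMixed (shearU v)) : mixedStep v = shearU v := by
  have h' := h.of_shearU
  refine mixedStep_of_lt ?_
  simp only [isMixed_iff, shearU_zero, shearU_one] at h h'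
  rcases h' with h' | h'
  · rw [abs_of_neg h'.2, abs_of_pos h'.1]
    grind
  · rw [abs_of_pos h'.2, abs_of_neg h'.1]
    grind

/-- On the history of a mixed point every shear is a `mixedStep`, which commutes with the swap.
Hence only the number `l` of shears matters. -/
lemma card_mixedPart_orbit_swap_shearU (a : Fin 2 → ℝ) (k : ℕ) :
    (mixedPart (orbit swap shearU a k)).card ≤ k + 1 := by
  have key : ∀ k, ∀ v ∈ mixedPart (orbit swap shearU a k),
      v ∈ (Finset.range (k + 1)).image fun l => mixedStep^[l] (swap^[k - l] a) := by
    intro k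
    induction k with
    | zero =>
      intro v hv
      simpa [orbit] using (mem_mixedPart.1 hv).1
    | succ k ih =>
      intro v hv
      obtain ⟨hv, hm⟩ := mem_mixedPart.1 hv
      obtain ⟨w, hw, rfl | rfl⟩ := mem_orbit_succ.1 hv
      · obtain ⟨l, hl, rfl⟩ := Finset.mem_image.1 (ih w (mem_mixedPart.2 ⟨hw, isMixed_swap.1 hm⟩))
        rw [Finset.mem_range] at hl
        refine Finset.mem_image.2 ⟨l, Finset.mem_range.2 (by omega), ?_⟩
        rw [← mixedStep_iterate_swap, ← Function.iterate_succ_apply' swap,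
          Nat.succ_sub (by omega)]
      · obtain ⟨l, hl, rfl⟩ := Finset.mem_image.1 (ih w (mem_mixedPart.2 ⟨hw, hm.of_shearU⟩))
        rw [Finset.mem_range] at hl
        refine Finset.mem_image.2 ⟨l + 1, Finset.mem_range.2 (by omega), ?_⟩
        rw [← mixedStep_eq_shearU hm, Function.iterate_succ_apply', Nat.add_sub_add_right]
  refine (Finset.card_le_card (key k)).trans (Finset.card_image_le.trans (by simp))

/-- The vector lies in the closed nonnegative quadrant. -/
def IsNonneg (v : Fin 2 → ℝ) : Prop := 0 ≤ v 0 ∧ 0 ≤ v 1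

lemma isNonneg_or_isMixed_or (v : Fin 2 → ℝ) : IsNonneg v ∨ IsMixed v ∨ IsNonneg (-v) := by
  by_cases h : IsMixed v
  · exact Or.inr (Or.inl h)
  · rcases nonneg_or_nonpos_of_not_isMixed h with h | h
    · exact Or.inl h
    · exact Or.inr (Or.inr (by simpa [IsNonneg] using h))

lemma isNonneg_or_isMixed_of_shearU (h : IsNonneg (shearU v)) : IsNonneg v ∨ IsMixed v := by
  rcases isNonneg_or_isMixed_or v with h' | h' | h'
  · exact Or.inl h'
  · exact Or.inr h'
  · left
    simp only [IsNonneg, shearU_zero, shearU_one, Pi.neg_apply] at *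
    grind

lemma isNonneg_swap : IsNonneg (swap v) ↔ IsNonneg v := and_comm

open Classical in
/-- The points of `X` in the closed nonnegative quadrant. -/
noncomputable def nonnegPart (X : Finset (Fin 2 → ℝ)) : Finset (Fin 2 → ℝ) := X.filter IsNonneg

lemma mem_nonnegPart : v ∈ nonnegPart X ↔ v ∈ X ∧ IsNonneg v := by simp [nonnegPart]

lemma nonnegPart_subset : nonnegPart X ⊆ X := fun _ hv => (mem_nonnegPart.1 hv).1

lemma shearL_mem_of_mem_mixCone (hc : c ∈ mixCone) : shearL c ∈ mixCone ∪ posCone := by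
  simp only [mixCone, posCone, Set.mem_union, Set.mem_ofPred_eq, shearL_zero, shearL_one] at hc ⊢
  grind

lemma shearL_mem_of_mem_neg_mixCone (hc : c ∈ -mixCone) : shearL c ∈ -mixCone ∪ -posCone := by
  simp only [mixCone, posCone, Set.mem_union, Set.mem_neg, Set.mem_ofPred_eq, shearL_zero,
    shearL_one, Pi.neg_apply] at hc ⊢
  grind

/-- For nonnegative `w`, a functional in `mixCone` values `shearU (swap w)` at least as highly as
`swap (shearU w)`. The branch through level `k` is thus absorbed by the shear branch, except at
mixed points and the pure power of the swap. -/
lemma card_nonnegPart_exposed_mixCone_succ (a : Fin 2 → ℝ) (k : ℕ) :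
    (nonnegPart (exposed mixCone (orbit swap shearU a (k + 2)))).card ≤
      (nonnegPart (exposed mixCone (orbit swap shearU a (k + 1)))).card + (6 * k + 10) := by
  have hsub : nonnegPart (exposed mixCone (orbit swap shearU a (k + 2))) ⊆
      (nonnegPart (exposed mixCone (orbit swap shearU a (k + 1))) ∪
        (exposed posCone (orbit swap shearU a (k + 1)) ∪
          mixedPart (orbit swap shearU a (k + 1)))).image shearU ∪
      ((mixedPart (orbit swap shearU a k)).image (swap ∘ shearU) ∪ {swap^[k + 2] a}) := by
    intro v hv
    obtain ⟨hv, hn⟩ := mem_nonnegPart.1 hv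
    obtain ⟨c, hc, h⟩ := mem_exposed.1 hv
    have hU : ∀ w ∈ orbit swap shearU a (k + 1), v = shearU w →
        v ∈ (nonnegPart (exposed mixCone (orbit swap shearU a (k + 1))) ∪
        (exposed posCone (orbit swap shearU a (k + 1)) ∪
          mixedPart (orbit swap shearU a (k + 1)))).image shearU := by
      rintro w hw rfl
      refine Finset.mem_image_of_mem _ ?_
      have he := h.of_map shearU_injective pair_shearU (fun _ => apply_right_mem_orbit) hw
      simp only [Finset.mem_union]
      rcases isNonneg_or_isMixed_of_shearU hn with hw' | hw'
      · rcases shearL_mem_of_mem_mixCone hc with hc' | hc'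
        · exact Or.inl (mem_nonnegPart.2 ⟨mem_exposed.2 ⟨_, hc', he⟩, hw'⟩)
        · exact Or.inr (Or.inl (mem_exposed.2 ⟨_, hc', he⟩))
      · exact Or.inr (Or.inr (mem_mixedPart.2 ⟨hw, hw'⟩))
    rcases orbit_swap_shearU_cases k h.1 with ⟨w, hw, hvw⟩ | ⟨w, hw, hvw⟩ | hvw
    · exact Finset.mem_union_left _ (hU w hw hvw)
    · have hw' : IsNonneg (shearU w) := isNonneg_swap.1 (hvw ▸ hn)
      rcases isNonneg_or_isMixed_of_shearU hw' with hw' | hw'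
      · refine Finset.mem_union_left _ (hU (swap w) (apply_left_mem_orbit hw) ?_)
        refine (h.eq_of_le (apply_right_mem_orbit (apply_left_mem_orbit hw)) ?_).symm
        rw [hvw]
        simp only [pair, shearU_zero, shearU_one, swap_zero, swap_one]
        nlinarith [mul_nonneg hc.1.le hw'.1, mul_nonneg (neg_nonneg.2 hc.2.le) hw'.2]
      · exact Finset.mem_union_right _ (Finset.mem_union_left _
          (Finset.mem_image.2 ⟨w, mem_mixedPart.2 ⟨hw, hw'⟩, hvw.symm⟩))
    · simp [hvw]
  have h0 := (Finset.card_le_card hsub).trans ((Finset.card_union_le _ _).trans (add_le_add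
    (Finset.card_image_le.trans ((Finset.card_union_le _ _).trans
      (add_le_add_right (Finset.card_union_le _ _) _)))
    ((Finset.card_union_le _ _).trans (add_le_add_left Finset.card_image_le _))))
  have h1 := card_exposed_posCone_swap_shearU a (k + 1)
  have h2 := card_mixedPart_orbit_swap_shearU a (k + 1)
  have h3 := card_mixedPart_orbit_swap_shearU a k
  rw [Finset.card_singleton] at h0
  omega

lemma card_nonnegPart_exposed_mixCone (a : Fin 2 → ℝ) (k : ℕ) :
    (nonnegPart (exposed mixCone (orbit swap shearU a k))).card ≤ 3 * k ^ 2 + 4 * k + 2 := by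
  rcases k with _ | k
  · exact (Finset.card_le_card nonnegPart_subset).trans
      ((card_exposed_orbit_zero_le _).trans (by norm_num))
  induction k with
  | zero =>
    exact (Finset.card_le_card nonnegPart_subset).trans
      ((card_exposed_orbit_one_le _).trans (by norm_num))
  | succ k ih =>
    have := card_nonnegPart_exposed_mixCone_succ a k
    nlinarith

/-- For `-mixCone` the preference is reversed, so an exposed `shearU (swap y)` with `y` nonnegative
is possible only in a tie. Restricting to shear images thus gives a recursion that stays among shear
images. -/
lemma card_nonnegPart_exposed_neg_mixCone_inter (a : Fin 2 → ℝ) (k : ℕ) :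
    (nonnegPart (exposed (-mixCone) (orbit swap shearU a (k + 1)) ∩
      (orbit swap shearU a k).image shearU)).card ≤ 3 * k ^ 2 + 5 * k + 1 := by
  induction k with
  | zero =>
    exact (Finset.card_le_card (nonnegPart_subset.trans Finset.inter_subset_right)).trans
      (Finset.card_image_le.trans (by simp [orbit]))
  | succ k ih =>
    have hsub : nonnegPart (exposed (-mixCone) (orbit swap shearU a (k + 2)) ∩
        (orbit swap shearU a (k + 1)).image shearU) ⊆
        (nonnegPart (exposed (-mixCone) (orbit swap shearU a (k + 1)) ∩
          (orbit swap shearU a k).image shearU) ∪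
        (exposed (-posCone) (orbit swap shearU a (k + 1)) ∪
          mixedPart (orbit swap shearU a (k + 1)))).image shearU := by
      intro v hv
      obtain ⟨hv, hn⟩ := mem_nonnegPart.1 hv
      obtain ⟨hv, hv'⟩ := Finset.mem_inter.1 hv
      obtain ⟨c, hc, h⟩ := mem_exposed.1 hv
      obtain ⟨w, hw, rfl⟩ := Finset.mem_image.1 hv'
      refine Finset.mem_image_of_mem _ ?_
      have he := h.of_map shearU_injective pair_shearU (fun _ => apply_right_mem_orbit) hw
      simp only [Finset.mem_union]
      rcases isNonneg_or_isMixed_of_shearU hn with hw' | hw'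
      swap
      · exact Or.inr (Or.inr (mem_mixedPart.2 ⟨hw, hw'⟩))
      rcases shearL_mem_of_mem_neg_mixCone hc with hc' | hc'
      swap
      · exact Or.inr (Or.inl (mem_exposed.2 ⟨_, hc', he⟩))
      refine Or.inl (mem_nonnegPart.2 ⟨Finset.mem_inter.2 ⟨mem_exposed.2 ⟨_, hc', he⟩, ?_⟩, hw'⟩)
      obtain ⟨y, hy, rfl | rfl⟩ := mem_orbit_succ.1 hw
      · have hy' : IsNonneg y := isNonneg_swap.1 hw'
        have hle : pair c (shearU (swap y)) ≤ pair c (swap (shearU y)) := by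
          have hc0 : 0 ≤ -c 0 := hc.1.le
          have hc1 : 0 ≤ c 1 := (neg_neg_iff_pos.1 hc.2).le
          simp only [pair, shearU_zero, shearU_one, swap_zero, swap_one]
          nlinarith [mul_nonneg hc0 hy'.1, mul_nonneg hc1 hy'.2]
        have heq := h.eq_of_le (apply_left_mem_orbit (apply_right_mem_orbit hy)) hle
        have h0 := congrFun heq 0
        have h1 := congrFun heq 1
        simp only [shearU_zero, shearU_one, swap_zero, swap_one] at h0 h1
        -- The tie forces `y = 0`, where `swap` and `shearU` agree.
        exact Finset.mem_image.2 ⟨y, hy, vec_ext (by simp; linarith) (by simp; linarith)⟩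
      · exact Finset.mem_image_of_mem _ hy
    have h0 := (Finset.card_le_card hsub).trans (Finset.card_image_le.trans
      ((Finset.card_union_le _ _).trans (add_le_add_right (Finset.card_union_le _ _) _)))
    have h1 := (card_exposed_neg_orbit_le (K := posCone) (a := a) (k := k + 1) swap_neg
      shearU_neg).trans (card_exposed_posCone_swap_shearU (-a) (k + 1))
    have h2 := card_mixedPart_orbit_swap_shearU a (k + 1)
    nlinarith

/-- An exposed swap image goes back to a point exposed by `mixCone`, which is already counted; only
shear images remain. -/
lemma card_nonnegPart_exposed_neg_mixCone (a : Fin 2 → ℝ) (k : ℕ) :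
    (nonnegPart (exposed (-mixCone) (orbit swap shearU a k))).card ≤ 6 * k ^ 2 + 9 * k + 3 := by
  rcases k with _ | k
  · exact (Finset.card_le_card nonnegPart_subset).trans
      ((card_exposed_orbit_zero_le _).trans (by norm_num))
  have hsub : nonnegPart (exposed (-mixCone) (orbit swap shearU a (k + 1))) ⊆
      nonnegPart (exposed (-mixCone) (orbit swap shearU a (k + 1)) ∩
        (orbit swap shearU a k).image shearU) ∪
      (nonnegPart (exposed mixCone (orbit swap shearU a k))).image swap := by
    intro v hv
    obtain ⟨hv, hn⟩ := mem_nonnegPart.1 hv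
    obtain ⟨c, hc, h⟩ := mem_exposed.1 hv
    obtain ⟨w, hw, rfl | rfl⟩ := mem_orbit_succ.1 h.1
    · refine Finset.mem_union_right _ (Finset.mem_image_of_mem _ (mem_nonnegPart.2
        ⟨mem_exposed.2 ⟨_, ?_,
          h.of_map swap_injective pair_swap (fun _ => apply_left_mem_orbit) hw⟩,
          isNonneg_swap.1 hn⟩))
      simpa [mixCone, and_comm] using hc
    · exact Finset.mem_union_left _ (mem_nonnegPart.2
        ⟨Finset.mem_inter.2 ⟨hv, Finset.mem_image_of_mem _ hw⟩, hn⟩)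
  have h0 := (Finset.card_le_card hsub).trans ((Finset.card_union_le _ _).trans
    (add_le_add_right Finset.card_image_le _))
  have h1 := card_nonnegPart_exposed_neg_mixCone_inter a k
  have h2 := card_nonnegPart_exposed_mixCone a k
  nlinarith

lemma card_exposed_mixCone_swap_shearU (a : Fin 2 → ℝ) (k : ℕ) :
    (exposed mixCone (orbit swap shearU a k)).card ≤ 9 * k ^ 2 + 14 * k + 6 := by
  have hsub : exposed mixCone (orbit swap shearU a k) ⊆
      nonnegPart (exposed mixCone (orbit swap shearU a k)) ∪
        (mixedPart (orbit swap shearU a k) ∪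
          (nonnegPart (exposed (-mixCone) (orbit swap shearU (-a) k))).image (-·)) := by
    intro v hv
    simp only [Finset.mem_union]
    rcases isNonneg_or_isMixed_or v with h | h | h
    · exact Or.inl (mem_nonnegPart.2 ⟨hv, h⟩)
    · exact Or.inr (Or.inl (mem_mixedPart.2 ⟨exposed_subset hv, h⟩))
    · refine Or.inr (Or.inr (Finset.mem_image.2 ⟨-v, mem_nonnegPart.2 ⟨?_, h⟩, neg_neg v⟩))
      exact neg_mem_exposed_orbit swap_neg shearU_neg (by rwa [neg_neg])
  have h0 := (Finset.card_le_card hsub).trans ((Finset.card_union_le _ _).trans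
    (add_le_add_right ((Finset.card_union_le _ _).trans
      (add_le_add_right Finset.card_image_le _)) _))
  have h1 := card_nonnegPart_exposed_mixCone a k
  have h2 := card_mixedPart_orbit_swap_shearU a k
  have h3 := card_nonnegPart_exposed_neg_mixCone (-a) k
  omega

lemma card_exposed_swap_shearU (a : Fin 2 → ℝ) (k : ℕ) :
    (exposed Set.univ (orbit swap shearU a k)).card ≤ 18 * (k + 1) ^ 2 := by
  have h0 := card_exposed_univ_le (X := orbit swap shearU a k)
  have h1 := card_exposed_posCone_swap_shearU a k
  have h2 := card_exposed_mixCone_swap_shearU a k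
  have h3 := (card_exposed_neg_orbit_le (K := posCone) (a := a) (k := k) swap_neg
    shearU_neg).trans (card_exposed_posCone_swap_shearU (-a) k)
  have h4 := (card_exposed_neg_orbit_le (K := mixCone) (a := a) (k := k) swap_neg
    shearU_neg).trans (card_exposed_mixCone_swap_shearU (-a) k)
  nlinarith

/-! ### Pairs that reduce to the pair of shears -/

lemma swap_mem_orbit_shears (h : x ∈ orbit shearU shearL a k) :
    swap x ∈ orbit shearU shearL (swap a) k := by
  induction k generalizing x with
  | zero =>
    simp only [orbit, Finset.mem_singleton] at h ⊢
    rw [h]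
  | succ k ih =>
    obtain ⟨w, hw, rfl | rfl⟩ := mem_orbit_succ.1 h
    · rw [swap_shearU]
      exact apply_right_mem_orbit (ih hw)
    · rw [swap_shearL]
      exact apply_left_mem_orbit (ih hw)

/-- Both maps are a shear after a swap, since `swap ∘ shearU = shearL ∘ swap`. The swap exchanges
the two shears, so all the swaps can be moved onto the initial vector. -/
lemma orbit_shearU_swap_swap_shearU (a : Fin 2 → ℝ) (k : ℕ) :
    orbit (shearU ∘ swap) (swap ∘ shearU) a k = orbit shearU shearL (swap^[k] a) k := by
  induction k with
  | zero => rfl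
  | succ k ih =>
    ext x
    rw [mem_orbit_succ, ih, mem_orbit_succ, Function.iterate_succ_apply']
    simp only [Function.comp_apply, swap_shearU]
    constructor
    · rintro ⟨w, hw, h⟩
      exact ⟨_, swap_mem_orbit_shears hw, h⟩
    · rintro ⟨w, hw, h⟩
      refine ⟨swap w, ?_, by rwa [swap_swap]⟩
      simpa only [swap_swap] using swap_mem_orbit_shears hw

lemma mem_orbit_succ_union {b : Fin 2 → ℝ} :
    x ∈ orbit f g a (k + 1) ∪ orbit f g b (k + 1) ↔
      ∃ w ∈ orbit f g a k ∪ orbit f g b k, x = f w ∨ x = g w := by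
  simp only [Finset.mem_union, mem_orbit_succ]
  grind

/-- Since `shearL = swap ∘ shearU ∘ swap`, closing the orbit under the swap makes both shears
available. -/
lemma mem_orbit_shearU_shearU_swap_or (a : Fin 2 → ℝ) (k : ℕ) (x : Fin 2 → ℝ) :
    (x ∈ orbit shearU (shearU ∘ swap) a k ∨ swap x ∈ orbit shearU (shearU ∘ swap) a k) ↔
      x ∈ orbit shearU shearL a k ∪ orbit shearU shearL (swap a) k := by
  induction k generalizing x with
  | zero =>
    simp only [orbit, Finset.mem_singleton, Finset.mem_union]
    exact or_congr_right ⟨fun h => by rw [← h, swap_swap], fun h => by rw [h, swap_swap]⟩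
  | succ k ih =>
    have hrec : ∀ y, y ∈ orbit shearU (shearU ∘ swap) a (k + 1) ↔
        ∃ w ∈ orbit shearU shearL a k ∪ orbit shearU shearL (swap a) k, y = shearU w := by
      intro y
      rw [mem_orbit_succ]
      simp only [← ih, Function.comp_apply]
      constructor
      · rintro ⟨w, hw, rfl | rfl⟩
        · exact ⟨w, Or.inl hw, rfl⟩
        · exact ⟨swap w, Or.inr (by rwa [swap_swap]), rfl⟩
      · rintro ⟨w, hw | hw, rfl⟩
        · exact ⟨w, hw, Or.inl rfl⟩
        · exact ⟨swap w, hw, Or.inr (by rw [swap_swap])⟩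
    have hswap : ∀ w, swap w ∈ orbit shearU shearL a k ∪ orbit shearU shearL (swap a) k ↔
        w ∈ orbit shearU shearL a k ∪ orbit shearU shearL (swap a) k := by
      intro w
      rw [← ih, ← ih, swap_swap, or_comm]
    rw [hrec, hrec, mem_orbit_succ_union]
    constructor
    · rintro (⟨w, hw, rfl⟩ | ⟨w, hw, h⟩)
      · exact ⟨w, hw, Or.inl rfl⟩
      · exact ⟨swap w, (hswap w).2 hw, Or.inr (by rw [← swap_shearU, ← h, swap_swap])⟩
    · rintro ⟨w, hw, rfl | rfl⟩
      · exact Or.inl ⟨w, hw, rfl⟩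
      · exact Or.inr ⟨swap w, (hswap w).2 hw, swap_shearL w⟩

lemma orbit_shearU_shearU_swap_succ (a : Fin 2 → ℝ) (k : ℕ) :
    orbit shearU (shearU ∘ swap) a (k + 1) =
      (orbit shearU shearL a k ∪ orbit shearU shearL (swap a) k).image shearU := by
  ext y
  rw [mem_orbit_succ, Finset.mem_image]
  simp only [← mem_orbit_shearU_shearU_swap_or, Function.comp_apply]
  constructor
  · rintro ⟨w, hw, rfl | rfl⟩
    · exact ⟨w, Or.inl hw, rfl⟩
    · exact ⟨swap w, Or.inr (by rwa [swap_swap]), rfl⟩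
  · rintro ⟨w, hw | hw, rfl⟩
    · exact ⟨w, hw, Or.inl rfl⟩
    · exact ⟨swap w, hw, Or.inr (by rw [swap_swap])⟩

/-- After one step the orbit is invariant under the swap, so the swap in `swap ∘ shearU = shearL ∘
swap` can be dropped from then on. -/
lemma orbit_shearU_swap_shearU_succ (a : Fin 2 → ℝ) (k : ℕ) :
    orbit shearU (swap ∘ shearU) a (k + 1) =
      orbit shearU shearL (shearU a) k ∪ orbit shearU shearL (swap (shearU a)) k := by
  induction k with
  | zero =>
    ext x
    simp [orbit]
  | succ k ih =>
    have hswap : ∀ w, w ∈ orbit shearU (swap ∘ shearU) a (k + 1) →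
        swap w ∈ orbit shearU (swap ∘ shearU) a (k + 1) := by
      intro w hw
      rw [ih, Finset.mem_union] at hw ⊢
      refine hw.symm.imp (fun h => ?_) swap_mem_orbit_shears
      simpa only [swap_swap] using swap_mem_orbit_shears h
    ext x
    rw [mem_orbit_succ, mem_orbit_succ_union, ← ih]
    simp only [Function.comp_apply, swap_shearU]
    constructor
    · rintro ⟨w, hw, rfl | rfl⟩
      · exact ⟨w, hw, Or.inl rfl⟩
      · exact ⟨swap w, hswap w hw, Or.inr rfl⟩
    · rintro ⟨w, hw, rfl | rfl⟩
      · exact ⟨w, hw, Or.inl rfl⟩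
      · exact ⟨swap w, hswap w hw, Or.inr (by rw [swap_swap])⟩

lemma card_exposed_shearU_shearU_swap (a : Fin 2 → ℝ) (k : ℕ) :
    (exposed Set.univ (orbit shearU (shearU ∘ swap) a (k + 1))).card ≤ 8 * (k + 1) ^ 2 := by
  rw [orbit_shearU_shearU_swap_succ]
  have h0 := (card_exposed_map_le shearU_injective pair_shearU
    (X := orbit shearU shearL a k ∪ orbit shearU shearL (swap a) k)).trans
      card_exposed_union_set_le
  have h1 := card_exposed_shears a k
  have h2 := card_exposed_shears (swap a) k
  omega

lemma card_exposed_shearU_swap_shearU (a : Fin 2 → ℝ) (k : ℕ) :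
    (exposed Set.univ (orbit shearU (swap ∘ shearU) a (k + 1))).card ≤ 8 * (k + 1) ^ 2 := by
  rw [orbit_shearU_swap_shearU_succ]
  have h0 := card_exposed_union_set_le (X := orbit shearU shearL (shearU a) k)
    (Y := orbit shearU shearL (swap (shearU a)) k)
  have h1 := card_exposed_shears (shearU a) k
  have h2 := card_exposed_shears (swap (shearU a)) k
  omega

/-- Conjugation by the swap does not increase the number of exposed points. -/
lemma card_exposed_orbit_conj_le {f' g' : (Fin 2 → ℝ) → (Fin 2 → ℝ)}
    (hf : ∀ x, f' (swap x) = swap (f x)) (hg : ∀ x, g' (swap x) = swap (g x))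
    (a : Fin 2 → ℝ) (k : ℕ) :
    (exposed Set.univ (orbit f' g' a k)).card ≤
      (exposed Set.univ (orbit f g (swap a) k)).card := by
  have : orbit f' g' a k = (orbit f g (swap a) k).image swap := by
    induction k with
    | zero => simp [orbit, swap_swap]
    | succ k ih =>
      ext x
      rw [mem_orbit_succ, ih, Finset.mem_image]
      constructor
      · rintro ⟨w, hw, h⟩
        obtain ⟨y, hy, rfl⟩ := Finset.mem_image.1 hw
        rw [hf, hg] at h
        rcases h with rfl | rfl
        · exact ⟨_, apply_left_mem_orbit hy, rfl⟩
        · exact ⟨_, apply_right_mem_orbit hy, rfl⟩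
      · rintro ⟨y, hy, rfl⟩
        obtain ⟨z, hz, rfl | rfl⟩ := mem_orbit_succ.1 hy
        · exact ⟨swap z, Finset.mem_image_of_mem _ hz, Or.inl (hf z).symm⟩
        · exact ⟨swap z, Finset.mem_image_of_mem _ hz, Or.inr (hg z).symm⟩
  rw [this]
  exact card_exposed_map_le swap_injective pair_swap

/-! ### Commuting and singular pairs -/

lemma card_exposed_orbit_of_commute (h : Function.Commute f g) (a : Fin 2 → ℝ) (k : ℕ) :
    (exposed Set.univ (orbit f g a k)).card ≤ k + 1 := by
  refine (Finset.card_le_card exposed_subset).trans ?_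
  have key : orbit f g a k ⊆ (Finset.range (k + 1)).image fun i => f^[i] (g^[k - i] a) := by
    induction k with
    | zero => simp [orbit]
    | succ k ih =>
      intro x hx
      obtain ⟨w, hw, hxw⟩ := mem_orbit_succ.1 hx
      obtain ⟨i, hi, rfl⟩ := Finset.mem_image.1 (ih hw)
      rw [Finset.mem_range] at hi
      refine Finset.mem_image.2 ?_
      rcases hxw with rfl | rfl
      · refine ⟨i + 1, Finset.mem_range.2 (by omega), ?_⟩
        rw [Function.iterate_succ_apply', Nat.add_sub_add_right]
      · refine ⟨i, Finset.mem_range.2 (by omega), ?_⟩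
        rw [Nat.succ_sub (by omega), Function.iterate_succ_apply', (h.iterate_left i).eq]
  exact (Finset.card_le_card key).trans (Finset.card_image_le.trans (by simp))

open Classical in
/-- At most two exposed points lie on a given line through the origin. -/
lemma card_exposed_filter_line_le (u : Fin 2 → ℝ) :
    ((exposed Set.univ X).filter fun v => ∃ s : ℝ, v = s • u).card ≤ 2 := by
  have hpair : ∀ (c : Fin 2 → ℝ) (s : ℝ), pair c (s • u) = s * pair c u := by
    intro c s
    simp only [pair, Pi.smul_apply, smul_eq_mul]
    ring
  -- On the line a functional depends only on `pair c u`; functionals with the same sign there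
  -- cannot expose two different points, and a vanishing one only creates ties.
  have hsub : ((exposed Set.univ X).filter fun v => ∃ s : ℝ, v = s • u) ⊆
      (exposed {c | 0 < pair c u} X).filter (fun v => ∃ s : ℝ, v = s • u) ∪
      (exposed {c | pair c u ≤ 0} X).filter (fun v => ∃ s : ℝ, v = s • u) := by
    intro v hv
    obtain ⟨hv, hs⟩ := Finset.mem_filter.1 hv
    obtain ⟨c, -, h⟩ := mem_exposed.1 hv
    rcases lt_or_ge 0 (pair c u) with hc | hc
    · exact Finset.mem_union_left _ (Finset.mem_filter.2 ⟨mem_exposed.2 ⟨c, hc, h⟩, hs⟩)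
    · exact Finset.mem_union_right _ (Finset.mem_filter.2 ⟨mem_exposed.2 ⟨c, hc, h⟩, hs⟩)
  refine (Finset.card_le_card hsub).trans ((Finset.card_union_le _ _).trans
    (Nat.add_le_add (Finset.card_le_one.2 ?_) (Finset.card_le_one.2 ?_) : _ ≤ 1 + 1))
  all_goals
    intro v hv w hw
    obtain ⟨hv, s, rfl⟩ := Finset.mem_filter.1 hv
    obtain ⟨hw, t, rfl⟩ := Finset.mem_filter.1 hw
    obtain ⟨c, hc, h⟩ := mem_exposed.1 hv
    obtain ⟨d, hd, h'⟩ := mem_exposed.1 hw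
    by_contra hne
    have h1 := h.2 _ h'.1 (Ne.symm hne)
    have h2 := h'.2 _ h.1 hne
    rw [hpair, hpair] at h1 h2
    simp only [Set.mem_ofPred_eq] at hc hd
    rcases le_total s t with hst | hst <;> nlinarith

/-- A product containing `f` ends on a line fixed by the number of `g` applied after the last `f`.
That leaves `k` lines, with at most two exposed points each, and the pure power of `g`. -/
lemma card_exposed_orbit_of_range_line {u : Fin 2 → ℝ} (hf : ∀ x, ∃ s : ℝ, f x = s • u)
    (hg : ∀ (s : ℝ) x, g (s • x) = s • g x) (a : Fin 2 → ℝ) (k : ℕ) :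
    (exposed Set.univ (orbit f g a k)).card ≤ 2 * k + 1 := by
  classical
  have key : ∀ k, ∀ x ∈ orbit f g a k, x = g^[k] a ∨ ∃ i < k, ∃ s : ℝ, x = s • g^[i] u := by
    intro k
    induction k with
    | zero =>
      intro x hx
      left
      simpa [orbit] using hx
    | succ k ih =>
      intro x hx
      obtain ⟨w, hw, rfl | rfl⟩ := mem_orbit_succ.1 hx
      · obtain ⟨s, hs⟩ := hf w
        exact Or.inr ⟨0, k.succ_pos, s, hs⟩
      · rcases ih w hw with rfl | ⟨i, hi, s, rfl⟩
        · exact Or.inl (Function.iterate_succ_apply' g k a).symm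
        · exact Or.inr ⟨i + 1, by omega, s, by rw [hg, Function.iterate_succ_apply']⟩
  have hsub : exposed Set.univ (orbit f g a k) ⊆ {g^[k] a} ∪
      (Finset.range k).biUnion fun i =>
        (exposed Set.univ (orbit f g a k)).filter fun v => ∃ s : ℝ, v = s • g^[i] u := by
    intro v hv
    rcases key k v (exposed_subset hv) with rfl | ⟨i, hi, hs⟩
    · simp
    · exact Finset.mem_union_right _ (Finset.mem_biUnion.2
        ⟨i, Finset.mem_range.2 hi, Finset.mem_filter.2 ⟨hv, hs⟩⟩)
  have h0 := (Finset.card_le_card hsub).trans (Finset.card_union_le _ _)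
  have h1 := Finset.card_biUnion_le_card_mul (Finset.range k)
    (fun i => (exposed Set.univ (orbit f g a k)).filter fun v => ∃ s : ℝ, v = s • g^[i] u) 2
    fun i _ => card_exposed_filter_line_le _
  rw [Finset.card_singleton] at h0
  rw [Finset.card_range] at h1
  omega

/-! ### Classification of binary matrices -/

lemma mulVec_swap (x : Fin 2 → ℝ) : !![0, 1; 1, 0] *ᵥ x = swap x :=
  vec_ext (by simp [mulVec, dotProduct]) (by simp [mulVec, dotProduct])

lemma mulVec_shearU (x : Fin 2 → ℝ) : !![1, 1; 0, 1] *ᵥ x = shearU x :=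
  vec_ext (by simp [mulVec, dotProduct]) (by simp [mulVec, dotProduct])

lemma mulVec_shearL (x : Fin 2 → ℝ) : !![1, 0; 1, 1] *ᵥ x = shearL x :=
  vec_ext (by simp [mulVec, dotProduct]) (by simp [mulVec, dotProduct])

lemma mulVec_shearU_swap (x : Fin 2 → ℝ) : !![1, 1; 1, 0] *ᵥ x = (shearU ∘ swap) x :=
  vec_ext (by simp [mulVec, dotProduct, add_comm]) (by simp [mulVec, dotProduct])

lemma mulVec_swap_shearU (x : Fin 2 → ℝ) : !![0, 1; 1, 1] *ᵥ x = (swap ∘ shearU) x :=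
  vec_ext (by simp [mulVec, dotProduct]) (by simp [mulVec, dotProduct])

lemma IsBinary.cases {A : Matrix (Fin 2) (Fin 2) ℝ} (hA : IsBinary A) :
    (∃ u : Fin 2 → ℝ, ∀ x, ∃ s : ℝ, A *ᵥ x = s • u) ∨ A = 1 ∨ A = !![0, 1; 1, 0] ∨
      A = !![1, 1; 0, 1] ∨ A = !![1, 0; 1, 1] ∨ A = !![1, 1; 1, 0] ∨ A = !![0, 1; 1, 1] := by
  by_cases hdet : A 0 0 * A 1 1 = A 0 1 * A 1 0
  · left
    by_cases h0 : A 0 0 = 0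
    · by_cases h1 : A 1 0 = 0
      · exact ⟨![A 0 1, A 1 1], fun x => ⟨x 1, vec_ext
          (by simp [mulVec, dotProduct, h0, mul_comm]) (by simp [mulVec, dotProduct, h1, mul_comm])⟩⟩
      · have h2 : A 0 1 = 0 := by simpa [h0, h1] using hdet
        refine ⟨![0, 1], fun x => ⟨A 1 0 * x 0 + A 1 1 * x 1, vec_ext ?_ ?_⟩⟩ <;>
          simp [mulVec, dotProduct, h0, h2]
    · refine ⟨![A 0 0, A 1 0], fun x => ⟨x 0 + A 0 1 / A 0 0 * x 1, vec_ext ?_ ?_⟩⟩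
      · simp only [mulVec, dotProduct, Fin.sum_univ_two, Pi.smul_apply, smul_eq_mul, cons_val_zero]
        field_simp
      · simp only [mulVec, dotProduct, Fin.sum_univ_two, Pi.smul_apply, smul_eq_mul, cons_val_one,
          cons_val_zero]
        field_simp
        linear_combination x 1 * hdet
  · right
    rw [eta_fin_two A, one_fin_two]
    rcases hA 0 0 with h00 | h00 <;> rcases hA 0 1 with h01 | h01 <;>
      rcases hA 1 0 with h10 | h10 <;> rcases hA 1 1 with h11 | h11 <;>
      simp [h00, h01, h10, h11] at hdet ⊢

/-! ### Bounds for the individual pairs -/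

variable {A B : Matrix (Fin 2) (Fin 2) ℝ}

lemma hasOligoVertexProperty_of_range_line
    (hA : ∃ u : Fin 2 → ℝ, ∀ x, ∃ s : ℝ, A *ᵥ x = s • u) : HasOligoVertexProperty {A, B} := by
  obtain ⟨u, hu⟩ := hA
  refine ⟨1, one_pos, numExtremeIsBigOPow_of_card_le (C := 3) (n := 1) (fun _ => rfl)
    (fun _ => rfl) 1 (by simp) (by simp) fun a k hk => ?_⟩
  refine (card_exposed_orbit_of_range_line hu (fun s x => mulVec_smul _ _ _) a k).trans ?_
  rw [pow_one]
  omega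

lemma hasOligoVertexProperty_of_commute (h : Commute A B) : HasOligoVertexProperty {A, B} := by
  refine ⟨1, one_pos, numExtremeIsBigOPow_of_card_le (C := 2) (n := 1) (fun _ => rfl)
    (fun _ => rfl) 1 (by simp) (by simp) fun a k hk => ?_⟩
  refine (card_exposed_orbit_of_commute (fun x => ?_) a k).trans ?_
  · simp only [mulVec_mulVec]
    rw [h.eq]
  · rw [pow_one]
    omega

lemma numExtremeIsBigOPow_swap_shearU :
    NumExtremeIsBigOPow {!![0, 1; 1, 0], !![1, 1; 0, 1]} 4 :=
  numExtremeIsBigOPow_of_card_le (C := 72) (n := 4) mulVec_swap mulVec_shearU 4 (by simp)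
    (by simp) fun a k hk => (card_exposed_swap_shearU a k).trans (by
      have : (k + 1) ^ 2 ≤ (2 * k) ^ 2 := Nat.pow_le_pow_left (by omega) 2
      -- The exponent four is a weakening of the quadratic bound.
      have : k ^ 2 ≤ k ^ 4 := Nat.pow_le_pow_right hk (by norm_num)
      nlinarith)

lemma numExtremeIsBigOPow_swap_shearL :
    NumExtremeIsBigOPow {!![0, 1; 1, 0], !![1, 0; 1, 1]} 2 :=
  numExtremeIsBigOPow_of_card_le (C := 72) (n := 2) mulVec_swap mulVec_shearL 2 (by simp)
    (by simp) fun a k hk => ((card_exposed_orbit_conj_le (fun _ => rfl)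
      (fun x => (swap_shearU x).symm) a k).trans (card_exposed_swap_shearU _ k)).trans (by
      have : (k + 1) ^ 2 ≤ (2 * k) ^ 2 := Nat.pow_le_pow_left (by omega) 2
      nlinarith)

lemma numExtremeIsBigOPow_swap_shearU_swap :
    NumExtremeIsBigOPow {!![0, 1; 1, 0], !![1, 1; 1, 0]} 1 :=
  numExtremeIsBigOPow_of_card_le (C := 6) (n := 1) mulVec_swap mulVec_shearU_swap 1 (by simp)
    (by simp) fun a k hk => by
      refine (card_exposed_swap_shearU_swap a k).trans ?_
      rw [pow_one]
      omega

lemma numExtremeIsBigOPow_swap_swap_shearU :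
    NumExtremeIsBigOPow {!![0, 1; 1, 0], !![0, 1; 1, 1]} 1 :=
  numExtremeIsBigOPow_of_card_le (C := 6) (n := 1) mulVec_swap mulVec_swap_shearU 1 (by simp)
    (by simp) fun a k hk => by
      refine ((card_exposed_orbit_conj_le (f := swap) (g := shearU ∘ swap) (fun _ => rfl)
        (fun _ => rfl) a k).trans (card_exposed_swap_shearU_swap _ k)).trans ?_
      rw [pow_one]
      omega

lemma numExtremeIsBigOPow_shears :
    NumExtremeIsBigOPow {!![1, 1; 0, 1], !![1, 0; 1, 1]} 2 :=
  numExtremeIsBigOPow_of_card_le (C := 16) (n := 2) mulVec_shearU mulVec_shearL 2 (by simp)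
    (by simp) fun a k hk => (card_exposed_shears a k).trans (by
      have : (k + 1) ^ 2 ≤ (2 * k) ^ 2 := Nat.pow_le_pow_left (by omega) 2
      nlinarith)

lemma numExtremeIsBigOPow_shearU_swap_swap_shearU :
    NumExtremeIsBigOPow {!![1, 1; 1, 0], !![0, 1; 1, 1]} 2 :=
  numExtremeIsBigOPow_of_card_le (C := 16) (n := 2) mulVec_shearU_swap mulVec_swap_shearU 2
    (by simp) (by simp) fun a k hk => by
      rw [orbit_shearU_swap_swap_shearU]
      refine (card_exposed_shears _ k).trans ?_
      have : (k + 1) ^ 2 ≤ (2 * k) ^ 2 := Nat.pow_le_pow_left (by omega) 2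
      nlinarith

lemma card_exposed_shearU_shearU_swap_of_pos (a : Fin 2 → ℝ) (hk : 0 < k) :
    (exposed Set.univ (orbit shearU (shearU ∘ swap) a k)).card ≤ 8 * k ^ 2 := by
  obtain ⟨k, rfl⟩ := Nat.exists_eq_succ_of_ne_zero hk.ne'
  exact card_exposed_shearU_shearU_swap a k

lemma card_exposed_shearU_swap_shearU_of_pos (a : Fin 2 → ℝ) (hk : 0 < k) :
    (exposed Set.univ (orbit shearU (swap ∘ shearU) a k)).card ≤ 8 * k ^ 2 := by
  obtain ⟨k, rfl⟩ := Nat.exists_eq_succ_of_ne_zero hk.ne'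
  exact card_exposed_shearU_swap_shearU a k

lemma numExtremeIsBigOPow_shearU_shearU_swap :
    NumExtremeIsBigOPow {!![1, 1; 0, 1], !![1, 1; 1, 0]} 2 :=
  numExtremeIsBigOPow_of_card_le (C := 8) (n := 2) mulVec_shearU mulVec_shearU_swap 2 (by simp)
    (by simp) fun a _ hk => card_exposed_shearU_shearU_swap_of_pos a hk

lemma numExtremeIsBigOPow_shearU_swap_shearU :
    NumExtremeIsBigOPow {!![1, 1; 0, 1], !![0, 1; 1, 1]} 2 :=
  numExtremeIsBigOPow_of_card_le (C := 8) (n := 2) mulVec_shearU mulVec_swap_shearU 2 (by simp)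
    (by simp) fun a _ hk => card_exposed_shearU_swap_shearU_of_pos a hk

lemma numExtremeIsBigOPow_shearL_shearU_swap :
    NumExtremeIsBigOPow {!![1, 0; 1, 1], !![1, 1; 1, 0]} 2 :=
  numExtremeIsBigOPow_of_card_le (C := 8) (n := 2) mulVec_shearL mulVec_shearU_swap 2 (by simp)
    (by simp) fun a k hk => (card_exposed_orbit_conj_le (fun x => (swap_shearU x).symm)
      (fun _ => by simp only [Function.comp_apply, swap_swap]) a k).trans
      (card_exposed_shearU_swap_shearU_of_pos _ hk)

lemma numExtremeIsBigOPow_shearL_swap_shearU :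
    NumExtremeIsBigOPow {!![1, 0; 1, 1], !![0, 1; 1, 1]} 2 :=
  numExtremeIsBigOPow_of_card_le (C := 8) (n := 2) mulVec_shearL mulVec_swap_shearU 2 (by simp)
    (by simp) fun a k hk => (card_exposed_orbit_conj_le (f := shearU) (g := shearU ∘ swap)
      (fun x => (swap_shearU x).symm) (fun _ => rfl) a k).trans (card_exposed_shearU_shearU_swap_of_pos _ hk)

lemma hasOligoVertexProperty_of_isBinary (hA : IsBinary A) (hB : IsBinary B) :
    HasOligoVertexProperty {A, B} := by
  have h12 : HasOligoVertexProperty _ := ⟨4, by norm_num, numExtremeIsBigOPow_swap_shearU⟩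
  have h13 : HasOligoVertexProperty _ := ⟨2, by norm_num, numExtremeIsBigOPow_swap_shearL⟩
  have h14 : HasOligoVertexProperty _ := ⟨1, by norm_num, numExtremeIsBigOPow_swap_shearU_swap⟩
  have h15 : HasOligoVertexProperty _ := ⟨1, by norm_num, numExtremeIsBigOPow_swap_swap_shearU⟩
  have h23 : HasOligoVertexProperty _ := ⟨2, by norm_num, numExtremeIsBigOPow_shears⟩
  have h24 : HasOligoVertexProperty _ := ⟨2, by norm_num, numExtremeIsBigOPow_shearU_shearU_swap⟩
  have h25 : HasOligoVertexProperty _ := ⟨2, by norm_num, numExtremeIsBigOPow_shearU_swap_shearU⟩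
  have h34 : HasOligoVertexProperty _ := ⟨2, by norm_num, numExtremeIsBigOPow_shearL_shearU_swap⟩
  have h35 : HasOligoVertexProperty _ := ⟨2, by norm_num, numExtremeIsBigOPow_shearL_swap_shearU⟩
  have h45 : HasOligoVertexProperty _ :=
    ⟨2, by norm_num, numExtremeIsBigOPow_shearU_swap_swap_shearU⟩
  rcases hA.cases with hA | rfl | hA
  · exact hasOligoVertexProperty_of_range_line hA
  · exact hasOligoVertexProperty_of_commute (Commute.one_left B)
  rcases hB.cases with hB | rfl | hB
  · rw [Set.pair_comm]
    exact hasOligoVertexProperty_of_range_line hB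
  · exact hasOligoVertexProperty_of_commute (Commute.one_right A)
  rcases hA with rfl | rfl | rfl | rfl | rfl <;> rcases hB with rfl | rfl | rfl | rfl | rfl <;>
    first
    | exact hasOligoVertexProperty_of_commute (Commute.refl _)
    | assumption
    | rw [Set.pair_comm]; assumption

end OligoVertex

theorem mainTheorem1 :
    (∀ A B : Matrix (Fin 2) (Fin 2) ℝ, OligoVertex.IsBinary A → OligoVertex.IsBinary B →
      OligoVertex.HasOligoVertexProperty ({A, B} : Set (Matrix (Fin 2) (Fin 2) ℝ))) ∧
    OligoVertex.NumExtremeIsBigOPow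
      ({!![0, 1; 1, 0], !![1, 1; 0, 1]} : Set (Matrix (Fin 2) (Fin 2) ℝ)) 4 ∧
    OligoVertex.NumExtremeIsBigOPow
      ({!![0, 1; 1, 0], !![1, 1; 1, 0]} : Set (Matrix (Fin 2) (Fin 2) ℝ)) 1 ∧
    OligoVertex.NumExtremeIsBigOPow
      ({!![1, 1; 0, 1], !![1, 0; 1, 1]} : Set (Matrix (Fin 2) (Fin 2) ℝ)) 2 ∧
    OligoVertex.NumExtremeIsBigOPow
      ({!![1, 1; 1, 0], !![0, 1; 1, 1]} : Set (Matrix (Fin 2) (Fin 2) ℝ)) 2 ∧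
    OligoVertex.NumExtremeIsBigOPow
      ({!![1, 1; 0, 1], !![1, 1; 1, 0]} : Set (Matrix (Fin 2) (Fin 2) ℝ)) 2 := by
  open OligoVertex in
  exact ⟨fun _ _ => hasOligoVertexProperty_of_isBinary, numExtremeIsBigOPow_swap_shearU,
    numExtremeIsBigOPow_swap_shearU_swap, numExtremeIsBigOPow_shears,
    numExtremeIsBigOPow_shearU_swap_swap_shearU, numExtremeIsBigOPow_shearU_shearU_swap⟩
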